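/- Let $W$ be a finite Coxeter group with set $S$ of simple reflections, with length function $\lambda$, and let $p$ be a prime. For $J\subseteq S$ let $W_J$ be the subgroup generated by $J$, let $X_J$ be the set of elements $w\in W$ of minimal length in their left coset $wW_J$, and put $x_J=\sum_{w\in X_J}w\in\mathbb Z[W]$. Let $\mathcal Z_W\subseteq\mathbb Z[W]$ be the subring generated by the elements $x_J$ ($J\subseteq S$), let $\Sigma(W,p)=\mathcal Z_W/p\mathcal Z_W$ be the $p$-modular descent algebra, an algebra over $\mathbb F_p$, let $\rho_1:\mathcal Z_W\to\Sigma(W,p)$ be the projection, and write $\overline x_J=\rho_1(x_J)$. Let $\chi_J$ be the permutation character of $W$ on the cosets of $W_J$. Call $J,K\subseteq S$ conjugate if $wJw^{-1}=K$ for some $w\in W$. Then $\mathcal Z_W$ is the $\mathbb Z$-span of the elements $x_J$; there is a (necessarily unique) ring homomorphism $\theta$ from $\mathcal Z_W$ to the ring of functions $W\to\mathbb Z$ with $\theta(x_J)=\chi_J$ for all $J\subseteq S$; and there is a (necessarily unique) $\mathbb F_p$-algebra homomorphism $\phi$ from $\Sigma(W,p)$ to the algebra of functions $W\to\mathbb F_p$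 such that $\phi(\rho_1(x))$ is the reduction of $\theta(x)$ modulo $p$ for all $x\in\mathcal Z_W$. Moreover, $$\operatorname{rad}(\Sigma(W,p))=\ker\phi,$$ where $\operatorname{rad}$ denotes the Jacobson radical, and $\operatorname{rad}(\Sigma(W,p))$ is the $\mathbb F_p$-linear span of all differences $\overline x_J-\overline x_K$ with $J,K$ conjugate subsets of $S$, together with all $\overline x_J$ for which $p$ divides $[N_W(W_J):W_J]$. -/

import Mathlib

namespace DescentAlgebra

noncomputable section

variable {B W : Type*} [Group W] {M : CoxeterMatrix B} (cs : CoxeterSystem M W)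

/-- The set of simple reflections `s_i`, `i ∈ J`.  Subsets of the generating set
`S = {s_i | i ∈ B}` are given by subsets `J` of the index set `B`. -/
def simples (J : Set B) : Set W := cs.simple '' J

/-- The standard parabolic subgroup `W_J` generated by `J`. -/
def parabolic (J : Set B) : Subgroup W := Subgroup.closure (simples cs J)

/-- `X_J`: the elements of minimal length in their left coset `w W_J`. -/
def minimalReps (J : Set B) : Set W :=
  {w | ∀ u ∈ parabolic cs J, cs.length w ≤ cs.length (w * u)}

/-- Two subsets `J`, `K` of `S` are conjugate if `w J w⁻¹ = K` for some `w ∈ W`. -/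
def ConjSubsets (J K : Set B) : Prop :=
  ∃ w : W, MulAut.conj w '' simples cs J = simples cs K

/-- The permutation character `χ_J` of `W` on the cosets of `W_J`: its value at `w` is
the number of cosets fixed by `w`. -/
def permChar (J : Set B) (w : W) : ℤ :=
  (Nat.card (MulAction.fixedBy (W ⧸ parabolic cs J) w) : ℤ)

/-- The element `x_J = ∑_{w ∈ X_J} w` of the integral group ring. -/
def xElt [Finite W] (J : Set B) : MonoidAlgebra ℤ W :=
  ∑ w ∈ (Set.toFinite (minimalReps cs J)).toFinset, MonoidAlgebra.of ℤ W w

/-- The subring `𝓩_W` of `ℤ[W]` generated by the elements `x_J`.  That it is already the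
`ℤ`-span of the `x_J` is Solomon's theorem. -/
def integralDescentRing [Finite W] : Subalgebra ℤ (MonoidAlgebra ℤ W) :=
  Algebra.adjoin ℤ (Set.range (xElt cs))

/-- The element `x_J`, as an element of `𝓩_W`. -/
def xInt [Finite W] (J : Set B) : integralDescentRing cs :=
  ⟨xElt cs J, Algebra.subset_adjoin ⟨J, rfl⟩⟩

/-- The ideal `p 𝓩_W` of `𝓩_W`. -/
def pIdeal [Finite W] (p : ℕ) : Ideal (integralDescentRing cs) :=
  Ideal.span {(p : integralDescentRing cs)}

instance [Finite W] (p : ℕ) : (pIdeal cs p).IsTwoSided where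
  mul_mem_of_left b ha := by
    obtain ⟨c, rfl⟩ := Ideal.mem_span_singleton'.mp ha
    exact Ideal.mem_span_singleton'.mpr
      ⟨c * b, by rw [mul_assoc, mul_assoc, (Nat.cast_commute p b).eq]⟩

/-- The `p`-modular descent algebra `Σ(W, p) = 𝓩_W / p 𝓩_W`. -/
abbrev ModularDescentAlgebra [Finite W] (p : ℕ) : Type _ :=
  integralDescentRing cs ⧸ pIdeal cs p

/-- The natural projection `ρ₁ : 𝓩_W → Σ(W, p)`. -/
def reduction [Finite W] (p : ℕ) :
    integralDescentRing cs →+* ModularDescentAlgebra cs p :=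
  Ideal.Quotient.mk (pIdeal cs p)

theorem natCast_eq_zero [Finite W] (p : ℕ) : (p : ModularDescentAlgebra cs p) = 0 := by
  have h : reduction cs p (p : integralDescentRing cs) = 0 :=
    Ideal.Quotient.eq_zero_iff_mem.mpr (Ideal.subset_span rfl)
  rwa [map_natCast] at h

/-- The unique `𝔽_p`-vector space structure on `Σ(W, p)`. -/
instance [Finite W] (p : ℕ) : Module (ZMod p) (ModularDescentAlgebra cs p) :=
  AddCommGroup.zmodModule fun x => by rw [nsmul_eq_mul, natCast_eq_zero, zero_mul]

instance [Finite W] (p : ℕ) : Algebra (ZMod p) (ModularDescentAlgebra cs p) :=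
  Algebra.ofModule
    (fun r x y => ZMod.map_smul (AddMonoidHom.mulRight y) r x)
    (fun r x y => ZMod.map_smul (AddMonoidHom.mulLeft x) r y)

/-- The element `x̄_J = ρ₁(x_J)` of `Σ(W, p)`. -/
def xBar [Finite W] (p : ℕ) (J : Set B) : ModularDescentAlgebra cs p :=
  reduction cs p (xInt cs J)

end

end DescentAlgebra

/-! Everything is governed by minimal double coset representatives d. Solomon's rule `xElt_mul_xElt`
and Mackey's formula `permChar_mul_permChar` expand x_J x_K and χ_J χ_K over the same d, with terms
x_L and χ_L for the same L = d⁻¹Jd ∩ K. Since the x_J are linearly independent, θ is a well-defined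
ring homomorphism.

Because L ⊆ K, left multiplication is triangular with respect to |K|. Let c_K be the product of the
simple reflections in K. The geometric representation shows that c_K is not conjugate into W_L when
|L| < |K|, so Mackey's formula evaluated at c_K identifies the diagonal coefficient of x on x_K as
θ(x)(c_K) (`mul_xInt_sub_mem`). Modulo p, elements of ker φ strictly lower the rank, hence are
nilpotent, and ker φ lies in the radical. Conversely, evaluating φ at any w maps onto the field 𝔽_p,
which kills the radical.

As for generators, conjugate subsets have equal characters, and [N(W_K) : W_K] divides every value
of χ_K and equals χ_K(c_K). In a combination of pairwise nonconjugate J with index prime to p,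
evaluation at c_K with |K| maximal isolates one coefficient (`eq_zero_of_sum_mem_ker`), so these
generators exhaust ker φ. -/

namespace DescentAlgebra

noncomputable section

/-! ### Inversion sets and the exchange property -/

section Inversions

variable {B W : Type*} [Group W] {M : CoxeterMatrix B} (cs : CoxeterSystem M W)

theorem end_mul_apply {α : Type*} (f g : Function.End α) (x : α) : (f * g) x = f (g x) := rfl

theorem end_one_apply {α : Type*} (x : α) : (1 : Function.End α) x = x := rfl

open Classical in
/-- The action of a simple reflection on pairs of a group element and a sign. -/
def signedConj (i : B) : Function.End (W × ZMod 2) :=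
  fun x => (cs.simple i * x.1 * cs.simple i, x.2 + if x.1 = cs.simple i then 1 else 0)

theorem simple_mul_pow (i j : B) (n : ℕ) :
    cs.simple j * (cs.simple i * cs.simple j) ^ n =
      ((cs.simple i * cs.simple j) ^ n)⁻¹ * cs.simple j := by
  induction n with
  | zero => simp
  | succ n ih =>
    rw [pow_succ, ← mul_assoc, ih, mul_inv_rev]
    have : ((cs.simple i * cs.simple j) ^ n)⁻¹ * (cs.simple i * cs.simple j)⁻¹ =
        (cs.simple i * cs.simple j)⁻¹ * ((cs.simple i * cs.simple j) ^ n)⁻¹ := by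
      rw [← mul_inv_rev, ← mul_inv_rev, ← pow_succ, ← pow_succ']
    rw [← this, mul_inv_rev]
    simp [mul_assoc]

open Classical in
-- With c = s_i s_j, the letter applied at step k flips the sign exactly when t = c⁻ᵏ s_j, because
-- s_j conjugates c to its inverse.
theorem signedConj_pow (i j : B) (n : ℕ) (t : W) (e : ZMod 2) :
    ((signedConj cs i * signedConj cs j) ^ n) (t, e) =
      ((cs.simple i * cs.simple j) ^ n * t * ((cs.simple i * cs.simple j) ^ n)⁻¹,
        e + ∑ k ∈ Finset.range (2 * n),
          if t = ((cs.simple i * cs.simple j) ^ k)⁻¹ * cs.simple j then 1 else 0) := by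
  induction n with
  | zero => simp [end_one_apply]
  | succ n ih =>
    rw [pow_succ', end_mul_apply, ih, end_mul_apply]
    simp only [signedConj]
    set c := cs.simple i * cs.simple j with hc
    have hj : cs.simple j * c ^ n = (c ^ n)⁻¹ * cs.simple j := simple_mul_pow cs i j n
    have hcinv : c⁻¹ = cs.simple j * cs.simple i := by simp [hc]
    have h1 : (c ^ n * t * (c ^ n)⁻¹ = cs.simple j) ↔ t = (c ^ (2 * n))⁻¹ * cs.simple j := by
      rw [mul_inv_eq_iff_eq_mul, hj, ← eq_inv_mul_iff_mul_eq, two_mul, pow_add, mul_inv_rev,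
        mul_assoc]
    have h2 : (cs.simple j * (c ^ n * t * (c ^ n)⁻¹) * cs.simple j = cs.simple i) ↔
        t = (c ^ (2 * n + 1))⁻¹ * cs.simple j := by
      have : cs.simple j * (c ^ n * t * (c ^ n)⁻¹) * cs.simple j = cs.simple i ↔
          c ^ n * t * (c ^ n)⁻¹ = c⁻¹ * cs.simple j := by
        rw [hcinv]
        constructor
        · intro h; rw [← h]; simp [mul_assoc]
        · intro h; rw [h]; simp [mul_assoc]
      rw [this, mul_inv_eq_iff_eq_mul, mul_assoc c⁻¹, hj, ← eq_inv_mul_iff_mul_eq,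
        show 2 * n + 1 = n + 1 + n by ring, pow_add, pow_succ, mul_inv_rev (c ^ n * c),
        mul_inv_rev (c ^ n) c, mul_assoc, mul_assoc]
    ext
    · simp only [pow_succ', mul_inv_rev, hcinv]
      simp [hc, mul_assoc]
    · rw [show 2 * (n + 1) = 2 * n + 1 + 1 by ring, Finset.sum_range_succ, Finset.sum_range_succ]
      simp only [h1, h2]
      ring

theorem signedConj_isLiftable : M.IsLiftable (signedConj cs) := by
  classical
  intro i j
  refine funext fun ⟨t, e⟩ => ?_
  rw [signedConj_pow]
  -- As cᵐ = 1, the 2m sign conditions repeat with period m, so the flips cancel in pairs modulo 2.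
  have h : (cs.simple i * cs.simple j) ^ M i j = 1 := cs.simple_mul_simple_pow i j
  rw [h, two_mul, Finset.sum_range_add]
  simp only [pow_add, h, one_mul]
  rw [CharTwo.add_self_eq_zero]
  simp [end_one_apply]

/-- The action of `W` on pairs of a group element and a sign. -/
def signedAction : W →* Function.End (W × ZMod 2) :=
  cs.lift ⟨signedConj cs, signedConj_isLiftable cs⟩

theorem signedAction_apply (w t : W) (e : ZMod 2) :
    signedAction cs w (t, e) = (w * t * w⁻¹, e + (signedAction cs w (t, 0)).2) := by
  induction w using cs.simple_induction_left generalizing e with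
  | one => simp [end_one_apply]
  | mul_simple_left w i ih =>
    simp only [map_mul, end_mul_apply]
    rw [ih e, ih 0]
    simp only [signedAction, cs.lift_apply_simple, signedConj]
    simp [mul_assoc, add_assoc]

/-- The set of reflections that `w` inverts (on the right). -/
def invSet (w : W) : Set W := {t | (signedAction cs w (t, 0)).2 = 1}

theorem zmod_two_add_eq_one (a b : ZMod 2) : a + b = 1 ↔ ¬ (a = 1 ↔ b = 1) := by
  revert a b; decide

/-- The cocycle rule N(uv) = N(v) Δ v⁻¹N(u)v; nearly every later argument about lengths and descents
reduces to it. -/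
theorem mem_invSet_mul {u v t : W} :
    t ∈ invSet cs (u * v) ↔ ¬ (t ∈ invSet cs v ↔ v * t * v⁻¹ ∈ invSet cs u) := by
  simp only [invSet, Set.mem_ofPred_eq, map_mul, end_mul_apply]
  rw [signedAction_apply cs v t 0, signedAction_apply cs u, zmod_two_add_eq_one,
    zero_add]

theorem not_mem_invSet_one (t : W) : t ∉ invSet cs 1 := by
  simp only [invSet, Set.mem_ofPred_eq, map_one]
  simp [end_one_apply]

theorem mem_invSet_simple {i : B} {t : W} : t ∈ invSet cs (cs.simple i) ↔ t = cs.simple i := by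
  simp only [invSet, Set.mem_ofPred_eq, signedAction, cs.lift_apply_simple, signedConj]
  by_cases h : t = cs.simple i <;> simp [h]

theorem mem_invSet_mul_simple_self {w : W} {i : B} :
    cs.simple i ∈ invSet cs (w * cs.simple i) ↔ cs.simple i ∉ invSet cs w := by
  rw [mem_invSet_mul, mem_invSet_simple]
  simp

theorem mem_rightInvSeq_of_mem_invSet {ω : List B} {t : W} (h : t ∈ invSet cs (cs.wordProd ω)) :
    t ∈ cs.rightInvSeq ω := by
  induction ω with
  | nil => simpa using not_mem_invSet_one cs t (by simpa using h)
  | cons i ω ih =>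
    rw [CoxeterSystem.rightInvSeq, List.mem_cons]
    rw [cs.wordProd_cons, mem_invSet_mul, mem_invSet_simple] at h
    by_cases h' : t ∈ invSet cs (cs.wordProd ω)
    · exact Or.inr (ih h')
    · left
      have : cs.wordProd ω * t * (cs.wordProd ω)⁻¹ = cs.simple i := by tauto
      rw [← this]; group

/-- Deleting the letter that contributes the inversion `t`. -/
theorem exists_eraseIdx_of_mem_invSet {ω : List B} {t : W}
    (h : t ∈ invSet cs (cs.wordProd ω)) :
    ∃ j < ω.length, cs.wordProd ω * t = cs.wordProd (ω.eraseIdx j) := by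
  obtain ⟨j, hj, rfl⟩ := List.mem_iff_getElem.mp (mem_rightInvSeq_of_mem_invSet cs h)
  refine ⟨j, by simpa using hj, ?_⟩
  rw [← cs.wordProd_mul_getD_rightInvSeq, List.getD_eq_getElem _ 1 hj]

theorem length_mul_lt_of_mem_invSet {w t : W} (h : t ∈ invSet cs w) :
    cs.length (w * t) < cs.length w := by
  obtain ⟨ω, hω, rfl⟩ := cs.exists_isReduced w
  obtain ⟨j, hj, e⟩ := exists_eraseIdx_of_mem_invSet cs h
  rw [e, hω.eq]
  refine (cs.length_wordProd_le _).trans_lt ?_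
  rw [← List.length_eraseIdx_add_one hj]
  exact Nat.lt_succ_self _

theorem length_mul_simple_of_not_mem {w : W} {i : B} (h : cs.simple i ∉ invSet cs w) :
    cs.length (w * cs.simple i) = cs.length w + 1 := by
  have := length_mul_lt_of_mem_invSet cs ((mem_invSet_mul_simple_self cs).2 h)
  rw [cs.simple_mul_simple_cancel_right] at this
  rcases cs.length_mul_simple w i with h | h <;> omega

end Inversions

/-! ### Parabolic subgroups and minimal coset representatives -/

section Parabolic

variable {B W : Type*} [Group W] {M : CoxeterMatrix B} (cs : CoxeterSystem M W)

theorem simple_mem_parabolic {J : Set B} {i : B} (hi : i ∈ J) : cs.simple i ∈ parabolic cs J :=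
  Subgroup.subset_closure ⟨i, hi, rfl⟩

theorem parabolic_mono {J K : Set B} (h : J ⊆ K) : parabolic cs J ≤ parabolic cs K :=
  Subgroup.closure_mono (Set.image_mono h)

theorem exists_word_of_mem_parabolic {J : Set B} {v : W} (hv : v ∈ parabolic cs J) :
    ∃ ω : List B, (∀ i ∈ ω, i ∈ J) ∧ cs.wordProd ω = v := by
  induction hv using Subgroup.closure_induction with
  | mem x hx => obtain ⟨i, hi, rfl⟩ := hx; exact ⟨[i], by simpa using hi, by simp⟩
  | one => exact ⟨[], by simp, by simp⟩
  | mul x y _ _ hx hy =>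
    obtain ⟨a, ha, rfl⟩ := hx
    obtain ⟨b, hb, rfl⟩ := hy
    refine ⟨a ++ b, fun i hi => ?_, cs.wordProd_append a b⟩
    rcases List.mem_append.1 hi with h | h
    exacts [ha i h, hb i h]
  | inv x _ hx =>
    obtain ⟨a, ha, rfl⟩ := hx
    exact ⟨a.reverse, fun i hi => ha i (by simpa using hi), cs.wordProd_reverse a⟩

theorem wordProd_mem_parabolic {J : Set B} {ω : List B} (h : ∀ i ∈ ω, i ∈ J) :
    cs.wordProd ω ∈ parabolic cs J := by
  induction ω with
  | nil => simp
  | cons i ω ih =>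
    rw [cs.wordProd_cons]
    exact mul_mem (simple_mem_parabolic cs (h i (by simp))) (ih fun j hj => h j (by simp [hj]))

theorem invSet_subset_parabolic {J : Set B} {v : W} (hv : v ∈ parabolic cs J) :
    invSet cs v ⊆ parabolic cs J := by
  obtain ⟨ω, hω, rfl⟩ := exists_word_of_mem_parabolic cs hv
  intro t ht
  obtain ⟨j, -, e⟩ := exists_eraseIdx_of_mem_invSet cs ht
  have := wordProd_mem_parabolic cs (J := J) (ω := ω.eraseIdx j)
    fun i hi => hω i (List.mem_of_mem_eraseIdx hi)
  rw [← e] at this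
  exact (Subgroup.mul_mem_cancel_left _ hv).1 this

/-- If the last letter is not an inversion of the word, it is one of the remaining prefix, and
exchange yields a word in J shorter by two letters. -/
theorem wordProd_eq_one_of_forall_not_mem {J : Set B} (ω : List B) (hω : ∀ i ∈ ω, i ∈ J)
    (h : ∀ i ∈ J, cs.simple i ∉ invSet cs (cs.wordProd ω)) : cs.wordProd ω = 1 := by
  induction hn : ω.length using Nat.strong_induction_on generalizing ω with
  | _ n ih =>
    rcases List.eq_nil_or_concat ω with rfl | ⟨ω', i, rfl⟩
    · simp
    have hi : i ∈ J := hω i (by simp)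
    have h1 := h i hi
    rw [cs.wordProd_concat, mem_invSet_mul_simple_self, not_not] at h1
    obtain ⟨j, hj, e⟩ := exists_eraseIdx_of_mem_invSet cs h1
    have e' : cs.wordProd (ω'.concat i) = cs.wordProd (ω'.eraseIdx j) := by
      rw [cs.wordProd_concat, e]
    rw [e'] at h ⊢
    refine ih _ ?_ (ω'.eraseIdx j) (fun k hk => hω k ?_) h rfl
    · have := List.length_eraseIdx_add_one hj
      simp at hn
      omega
    · simp [List.mem_of_mem_eraseIdx hk]

theorem eq_one_of_mem_parabolic {J : Set B} {v : W} (hv : v ∈ parabolic cs J)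
    (h : ∀ i ∈ J, cs.simple i ∉ invSet cs v) : v = 1 := by
  obtain ⟨ω, hω, rfl⟩ := exists_word_of_mem_parabolic cs hv
  exact wordProd_eq_one_of_forall_not_mem cs ω hω h

theorem not_mem_invSet_of_mem_minimalReps {J : Set B} {w t : W} (hw : w ∈ minimalReps cs J)
    (ht : t ∈ parabolic cs J) : t ∉ invSet cs w := fun h =>
  (length_mul_lt_of_mem_invSet cs h).not_ge (hw t ht)

theorem mem_invSet_mul_of_mem_parabolic {J : Set B} {u v t : W} (hu : u ∈ minimalReps cs J)
    (hv : v ∈ parabolic cs J) (ht : t ∈ parabolic cs J) :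
    t ∈ invSet cs (u * v) ↔ t ∈ invSet cs v := by
  have := not_mem_invSet_of_mem_minimalReps cs hu
    (mul_mem (mul_mem hv ht) (inv_mem hv))
  rw [mem_invSet_mul]
  tauto

theorem exists_minimalReps_mul (J : Set B) (w : W) :
    ∃ u ∈ minimalReps cs J, ∃ v ∈ parabolic cs J, w = u * v := by
  obtain ⟨v, hv⟩ : ∃ v : parabolic cs J, ∀ v' : parabolic cs J,
      cs.length (w * v) ≤ cs.length (w * v') :=
    ⟨Function.argmin fun v : parabolic cs J => cs.length (w * v), fun v' =>
      Function.argmin_le (fun v : parabolic cs J => cs.length (w * v)) v'⟩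
  refine ⟨w * v, fun u hu => ?_, (v : W)⁻¹, inv_mem v.2, by simp⟩
  rw [mul_assoc]
  exact hv ⟨v * u, mul_mem v.2 hu⟩

/-- Write w = uv with u minimal and v ∈ W_J: by the cocycle rule the J-descents of w are those of v,
and only v = 1 has none. -/
theorem mem_minimalReps_iff {J : Set B} {w : W} :
    w ∈ minimalReps cs J ↔ ∀ i ∈ J, cs.simple i ∉ invSet cs w := by
  refine ⟨fun h i hi => not_mem_invSet_of_mem_minimalReps cs h (simple_mem_parabolic cs hi),
    fun h => ?_⟩
  obtain ⟨u, hu, v, hv, rfl⟩ := exists_minimalReps_mul cs J w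
  have : v = 1 := eq_one_of_mem_parabolic cs hv fun i hi hi' => h i hi
    ((mem_invSet_mul_of_mem_parabolic cs hu hv (simple_mem_parabolic cs hi)).2 hi')
  simpa [this] using hu

theorem minimalReps_mul_inj {J : Set B} {u u' v v' : W} (hu : u ∈ minimalReps cs J)
    (hu' : u' ∈ minimalReps cs J) (hv : v ∈ parabolic cs J) (hv' : v' ∈ parabolic cs J)
    (h : u * v = u' * v') : u = u' ∧ v = v' := by
  have hm := mul_mem hv (inv_mem hv')
  have e : u * (v * v'⁻¹) = u' := by rw [← mul_assoc, h]; simp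
  have : v * v'⁻¹ = 1 := eq_one_of_mem_parabolic cs hm fun i hi hi' =>
    (mem_minimalReps_iff cs).1 hu' i hi (e ▸
      (mem_invSet_mul_of_mem_parabolic cs hu hm (simple_mem_parabolic cs hi)).2 hi')
  rw [this, mul_one] at e
  exact ⟨e, mul_inv_eq_one.1 this⟩

/-- Strip a descent in J from v; by the cocycle rule it is also a descent of uv, so both lengths
drop by one. -/
theorem length_minimalReps_mul {J : Set B} {u v : W} (hu : u ∈ minimalReps cs J)
    (hv : v ∈ parabolic cs J) : cs.length (u * v) = cs.length u + cs.length v := by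
  induction hn : cs.length v using Nat.strong_induction_on generalizing v with
  | _ n ih =>
    by_cases h1 : v = 1
    · subst h1; simp at hn; simp [← hn]
    obtain ⟨i, hi, hiv⟩ : ∃ i ∈ J, cs.simple i ∈ invSet cs v := by
      by_contra! h
      exact h1 (eq_one_of_mem_parabolic cs hv h)
    have hs := simple_mem_parabolic cs hi
    have hm := mul_mem hv hs
    have hnot : cs.simple i ∉ invSet cs (v * cs.simple i) := by
      rwa [mem_invSet_mul_simple_self, not_not]
    have hl := length_mul_simple_of_not_mem cs hnot
    have hl' := length_mul_simple_of_not_mem cs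
      (mt (mem_invSet_mul_of_mem_parabolic cs hu hm hs).1 hnot)
    rw [mul_assoc, cs.simple_mul_simple_cancel_right] at hl'
    rw [cs.simple_mul_simple_cancel_right] at hl
    have := ih (cs.length (v * cs.simple i)) (by omega) hm rfl
    omega

theorem length_mul_minimalReps_inv {J : Set B} {u v : W} (hu : u⁻¹ ∈ minimalReps cs J)
    (hv : v ∈ parabolic cs J) : cs.length (v * u) = cs.length v + cs.length u := by
  rw [← cs.length_inv, mul_inv_rev, length_minimalReps_mul cs hu (inv_mem hv), cs.length_inv,
    cs.length_inv, add_comm]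

theorem exists_mem_of_simple_mem_parabolic {J : Set B} {i : B}
    (h : cs.simple i ∈ parabolic cs J) : ∃ j ∈ J, cs.simple i = cs.simple j := by
  by_contra! hne
  have := eq_one_of_mem_parabolic cs h fun j hj hj' =>
    hne j hj ((mem_invSet_simple cs).1 hj').symm
  simpa [this] using cs.length_simple i

end Parabolic

/-! ### Double cosets and intersections of parabolic subgroups -/

section DoubleCosets

variable {B W : Type*} [Group W] {M : CoxeterMatrix B} (cs : CoxeterSystem M W)

/-- The elements of minimal length in their double coset `W_J d W_K`. -/
def doubleReps (J K : Set B) : Set W := {d | d ∈ minimalReps cs K ∧ d⁻¹ ∈ minimalReps cs J}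

/-- The index set of `d⁻¹ J d ∩ K`. -/
def conjInter (J K : Set B) (d : W) : Set B :=
  {k | k ∈ K ∧ ∃ j ∈ J, d * cs.simple k * d⁻¹ = cs.simple j}

variable {cs} {J K : Set B} {d : W}

theorem conjInter_subset : conjInter cs J K d ⊆ K := fun _ h => h.1

/-- For h = d s_k d⁻¹ ∈ W_J, additivity gives ℓ(h) + ℓ(d) = ℓ(hd) = ℓ(d s_k) ≤ ℓ(d) + 1, so h ≠ 1
has length one. -/
theorem exists_simple_of_conj_mem (hd : d⁻¹ ∈ minimalReps cs J) {k : B}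
    (h : d * cs.simple k * d⁻¹ ∈ parabolic cs J) :
    ∃ j ∈ J, d * cs.simple k * d⁻¹ = cs.simple j := by
  have h1 := length_mul_minimalReps_inv cs hd h
  rw [inv_mul_cancel_right] at h1
  have h2 : cs.length (d * cs.simple k * d⁻¹) ≠ 0 := by
    rw [Ne, cs.length_eq_zero_iff]
    intro h0
    have : cs.simple k = 1 := by
      rw [mul_inv_eq_one] at h0
      simpa using h0
    simpa [this] using cs.length_simple k
  have h3 := cs.length_mul_le d (cs.simple k)
  rw [cs.length_simple] at h3
  obtain ⟨i, hi⟩ := (cs.length_eq_one_iff (w := d * cs.simple k * d⁻¹)).1 (by omega)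
  rw [hi] at h ⊢
  exact exists_mem_of_simple_mem_parabolic cs h

/-- Since d has no descent in K, a descent k ∈ K of ad comes from the inversion d s_k d⁻¹ of a,
which lies in W_J and is therefore simple. -/
theorem mem_minimalReps_mul_iff (hd : d ∈ doubleReps cs J K) {a : W} (ha : a ∈ parabolic cs J) :
    a * d ∈ minimalReps cs K ↔ a ∈ minimalReps cs (conjInter cs K J d⁻¹) := by
  have hdK := (mem_minimalReps_iff cs).1 hd.1
  simp only [mem_minimalReps_iff, mem_invSet_mul]
  constructor
  · rintro h j ⟨hj, k, hk, e⟩ hja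
    refine h k hk (fun h' => hdK k hk (h'.2 ?_))
    rw [← e]
    simpa [mul_assoc] using hja
  · intro h k hk
    rw [not_not]
    refine iff_of_false (hdK k hk) fun hka => ?_
    obtain ⟨j, hj, e⟩ := exists_simple_of_conj_mem hd.2 (invSet_subset_parabolic cs ha hka)
    refine h j ⟨hj, k, hk, ?_⟩ (e ▸ hka)
    rw [← e]
    simp [mul_assoc]

theorem mem_minimalReps_of_mul (hd : d⁻¹ ∈ minimalReps cs J) {a : W} (ha : a ∈ parabolic cs J)
    (h : a * d ∈ minimalReps cs K) : d ∈ minimalReps cs K := by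
  rw [mem_minimalReps_iff] at h ⊢
  intro k hk hkd
  have h1 := h k hk
  rw [mem_invSet_mul] at h1
  have h2 := invSet_subset_parabolic cs ha (show d * cs.simple k * d⁻¹ ∈ invSet cs a by tauto)
  have h3 := length_mul_minimalReps_inv cs hd h2
  rw [inv_mul_cancel_right] at h3
  have := length_mul_lt_of_mem_invSet cs hkd
  omega

theorem exists_eq_mul_doubleReps {w : W} (J : Set B) (hw : w ∈ minimalReps cs K) :
    ∃ d ∈ doubleReps cs J K, ∃ a ∈ parabolic cs J,
      a ∈ minimalReps cs (conjInter cs K J d⁻¹) ∧ w = a * d := by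
  obtain ⟨u, hu, v, hv, e⟩ := exists_minimalReps_mul cs J w⁻¹
  have e' : w = v⁻¹ * u⁻¹ := by rw [← mul_inv_rev, ← e, inv_inv]
  have hu' : u⁻¹⁻¹ ∈ minimalReps cs J := by simpa using hu
  have hd : u⁻¹ ∈ doubleReps cs J K :=
    ⟨mem_minimalReps_of_mul hu' (inv_mem hv) (e' ▸ hw), hu'⟩
  exact ⟨u⁻¹, hd, v⁻¹, inv_mem hv, (mem_minimalReps_mul_iff hd (inv_mem hv)).1 (e' ▸ hw), e'⟩

theorem mul_doubleReps_inj {d' a a' : W} (hd : d⁻¹ ∈ minimalReps cs J)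
    (hd' : d'⁻¹ ∈ minimalReps cs J) (ha : a ∈ parabolic cs J) (ha' : a' ∈ parabolic cs J)
    (h : a * d = a' * d') : a = a' ∧ d = d' := by
  have := minimalReps_mul_inj cs hd hd' (inv_mem ha) (inv_mem ha')
    (by rw [← mul_inv_rev, h, mul_inv_rev])
  exact ⟨inv_injective this.2, inv_injective this.1⟩

theorem conj_mem_parabolic_of_mem_conjInter {y : W} (hy : y ∈ parabolic cs (conjInter cs J K d)) :
    d * y * d⁻¹ ∈ parabolic cs (conjInter cs K J d⁻¹) := by
  induction hy using Subgroup.closure_induction with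
  | mem x hx =>
    obtain ⟨k, ⟨hk, j, hj, e⟩, rfl⟩ := hx
    rw [e]
    refine simple_mem_parabolic cs ⟨hj, k, hk, ?_⟩
    rw [← e]
    simp [mul_assoc]
  | one => simp
  | mul x y _ _ hx hy => simpa [mul_assoc] using mul_mem hx hy
  | inv x _ hx => simpa [mul_assoc] using inv_mem hx

/-- Kilmoyer's theorem on intersections of parabolic subgroups. -/
theorem mem_parabolic_conjInter (hd : d ∈ doubleReps cs J K) {y : W} (hy : y ∈ parabolic cs K)
    (hyJ : d * y * d⁻¹ ∈ parabolic cs J) : y ∈ parabolic cs (conjInter cs J K d) := by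
  induction hn : cs.length y using Nat.strong_induction_on generalizing y with
  | _ n ih =>
    by_cases h1 : y = 1
    · subst h1; exact one_mem _
    obtain ⟨k, hk, hky⟩ : ∃ k ∈ K, cs.simple k ∈ invSet cs y := by
      by_contra! h
      exact h1 (eq_one_of_mem_parabolic cs hy h)
    have hkK := simple_mem_parabolic cs hk
    -- Read dy as (dyd⁻¹)d. Since d does not invert s_k, the inversion must come from dyd⁻¹ ∈ W_J,
    -- which puts d s_k d⁻¹ in W_J.
    have h2 : cs.simple k ∈ invSet cs (d * y * d⁻¹ * d) := by
      rw [inv_mul_cancel_right]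
      exact (mem_invSet_mul_of_mem_parabolic cs hd.1 hy hkK).2 hky
    rw [mem_invSet_mul] at h2
    have h3 := not_mem_invSet_of_mem_minimalReps cs hd.1 hkK
    have h4 := invSet_subset_parabolic cs hyJ
      (show d * cs.simple k * d⁻¹ ∈ invSet cs (d * y * d⁻¹) by tauto)
    have h5 : cs.simple k ∈ parabolic cs (conjInter cs J K d) :=
      simple_mem_parabolic cs ⟨hk, exists_simple_of_conj_mem hd.2 h4⟩
    have h6 := ih _ (hn ▸ length_mul_lt_of_mem_invSet cs hky) (mul_mem hy hkK)
      (by simpa [mul_assoc] using mul_mem hyJ h4) rfl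
    simpa using mul_mem h6 h5

theorem mul_mem_minimalReps_conjInter_iff (hd : d ∈ doubleReps cs J K) {w : W} :
    w * d ∈ minimalReps cs (conjInter cs J K d) ↔
      w ∈ minimalReps cs (conjInter cs K J d⁻¹) := by
  have hdK := (mem_minimalReps_iff cs).1 hd.1
  simp only [mem_minimalReps_iff, mem_invSet_mul]
  constructor
  · rintro h j ⟨hj, k, hk, e⟩ hja
    have e' : d * cs.simple k * d⁻¹ = cs.simple j := by rw [← e]; simp [mul_assoc]
    exact h k ⟨hk, j, hj, e'⟩ fun h' => hdK k hk (h'.2 (e' ▸ hja))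
  · rintro h k ⟨hk, j, hj, e⟩
    rw [not_not]
    refine iff_of_false (hdK k hk) fun hka => h j ⟨hj, k, hk, ?_⟩ (e ▸ hka)
    rw [← e]; simp [mul_assoc]

theorem mul_mem_minimalReps_iff {L : Set B} (hL : L ⊆ J) {u a : W} (hu : u ∈ minimalReps cs J)
    (ha : a ∈ parabolic cs J) : u * a ∈ minimalReps cs L ↔ a ∈ minimalReps cs L := by
  simp only [mem_minimalReps_iff]
  exact forall₂_congr fun i hi => not_congr
    (mem_invSet_mul_of_mem_parabolic cs hu ha (simple_mem_parabolic cs (hL hi)))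

theorem exists_mul_doubleReps_mul (J K : Set B) (g : W) :
    ∃ d ∈ doubleReps cs J K, ∃ a ∈ parabolic cs J, ∃ b ∈ parabolic cs K, g = a * d * b := by
  obtain ⟨u, hu, b, hb, rfl⟩ := exists_minimalReps_mul cs K g
  obtain ⟨d, hd, a, ha, -, rfl⟩ := exists_eq_mul_doubleReps J hu
  exact ⟨d, hd, a, ha, b, hb, rfl⟩

/-- Split a = ul with l in the parabolic subgroup that d⁻¹ carries into W_K. Then adb =
(ud)(d⁻¹ld·b), and uniqueness of minimal representatives applies on each side. -/
theorem doubleReps_unique {d' a b : W} (hd : d ∈ doubleReps cs J K)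
    (hd' : d' ∈ doubleReps cs J K) (ha : a ∈ parabolic cs J) (hb : b ∈ parabolic cs K)
    (h : d' = a * d * b) : d' = d := by
  obtain ⟨u, hu, l, hl, rfl⟩ := exists_minimalReps_mul cs (conjInter cs K J d⁻¹) a
  have hl' := conj_mem_parabolic_of_mem_conjInter hl
  rw [inv_inv] at hl'
  have hlK := parabolic_mono cs conjInter_subset hl'
  have huJ : u ∈ parabolic cs J :=
    (Subgroup.mul_mem_cancel_right _ (parabolic_mono cs conjInter_subset hl)).1 ha
  have h1 := minimalReps_mul_inj cs hd'.1 ((mem_minimalReps_mul_iff hd huJ).2 hu) (one_mem _)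
    (mul_mem hlK hb) (by rw [mul_one, h]; simp [mul_assoc])
  exact (mul_doubleReps_inj hd'.2 hd.2 (one_mem _) huJ (by rw [one_mul, h1.1])).2

end DoubleCosets

/-! ### Multiplication of the elements x_J -/

section Product

variable {B W : Type*} [Group W] [Finite W] {M : CoxeterMatrix B} (cs : CoxeterSystem M W)

theorem coe_xElt_eq_sum (J : Set B) [DecidablePred (· ∈ minimalReps cs J)] [Fintype W] :
    xElt cs J = ∑ w with w ∈ minimalReps cs J, MonoidAlgebra.of ℤ W w := by
  unfold xElt
  congr 1
  ext; simp

open Classical in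
/-- Solomon's multiplication rule. -/
theorem xElt_mul_xElt (J K : Set B) [Fintype W] :
    xElt cs J * xElt cs K =
      ∑ d with d ∈ doubleReps cs J K, xElt cs (conjInter cs J K d) := by
  simp only [coe_xElt_eq_sum, Finset.sum_mul_sum, ← Finset.sum_product', ← map_mul]
  rw [Finset.sum_sigma']
  -- Both sides are sums over triples (u, a, d): the left groups them as (u, ad), the right as (d,
  -- uad).
  let T : Finset (W × W × W) := {x | x.1 ∈ minimalReps cs J ∧ x.2.1 ∈ parabolic cs J ∧
    x.2.1 ∈ minimalReps cs (conjInter cs K J x.2.2⁻¹) ∧ x.2.2 ∈ doubleReps cs J K}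
  trans ∑ x ∈ T, MonoidAlgebra.of ℤ W (x.1 * x.2.1 * x.2.2)
  · symm
    refine Finset.sum_nbij (fun x => (x.1, x.2.1 * x.2.2)) ?_ ?_ ?_ ?_
    · rintro ⟨u, a, d⟩ h
      simp only [T, Finset.mem_filter, Finset.mem_univ, true_and, Finset.mem_product] at h ⊢
      exact ⟨h.1, (mem_minimalReps_mul_iff h.2.2.2 h.2.1).2 h.2.2.1⟩
    · rintro ⟨u, a, d⟩ h ⟨u', a', d'⟩ h' e
      simp only [T, Finset.coe_filter, Finset.mem_univ, true_and, Set.mem_ofPred_eq,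
        Prod.mk.injEq] at h h' e ⊢
      exact ⟨e.1, mul_doubleReps_inj h.2.2.2.2 h'.2.2.2.2 h.2.1 h'.2.1 e.2⟩
    · rintro ⟨u, w⟩ h
      simp only [Finset.coe_product, Finset.coe_filter, Finset.mem_univ, true_and, Set.mem_prod,
        Set.mem_ofPred_eq] at h
      obtain ⟨d, hd, a, ha, ha', rfl⟩ := exists_eq_mul_doubleReps J h.2
      exact ⟨(u, a, d), by simpa [T] using ⟨h.1, ha, ha', hd⟩, rfl⟩
    · intro x _
      simp [mul_assoc]
  · refine Finset.sum_nbij (fun x => ⟨x.2.2, x.1 * x.2.1 * x.2.2⟩) ?_ ?_ ?_ ?_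
    · rintro ⟨u, a, d⟩ h
      simp only [T, Finset.mem_filter, Finset.mem_univ, true_and, Finset.mem_sigma] at h ⊢
      exact ⟨h.2.2.2, (mul_mem_minimalReps_conjInter_iff h.2.2.2).2
        ((mul_mem_minimalReps_iff conjInter_subset h.1 h.2.1).2 h.2.2.1)⟩
    · rintro ⟨u, a, d⟩ h ⟨u', a', d'⟩ h' e
      simp only [T, Finset.coe_filter, Finset.mem_univ, true_and, Set.mem_ofPred_eq,
        Sigma.mk.injEq, Prod.mk.injEq] at h h' e ⊢
      obtain ⟨rfl, e⟩ := e
      have := minimalReps_mul_inj cs h.1 h'.1 h.2.1 h'.2.1 (mul_right_cancel (eq_of_heq e))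
      exact ⟨this.1, this.2, rfl⟩
    · rintro ⟨d, w⟩ h
      simp only [Finset.coe_sigma, Finset.coe_filter, Finset.mem_univ, true_and, Set.mem_sigma_iff,
        Set.mem_ofPred_eq] at h
      obtain ⟨u, hu, a, ha, e⟩ := exists_minimalReps_mul cs J (w * d⁻¹)
      have hw : w = u * a * d := by rw [← e]; simp
      subst hw
      refine ⟨(u, a, d), ?_, rfl⟩
      simpa [T] using ⟨hu, ha, (mul_mem_minimalReps_iff conjInter_subset hu ha).1
        ((mul_mem_minimalReps_conjInter_iff h.1).1 h.2), h.1⟩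
    · intro x _
      rfl

end Product

/-! ### Products of permutation characters -/

section Mackey

theorem smul_mk_eq_mk_iff {G : Type*} [Group G] (H : Subgroup G) (w g : G) :
    w • (g : G ⧸ H) = (g : G ⧸ H) ↔ g⁻¹ * w * g ∈ H := by
  rw [MulAction.Quotient.smul_mk, smul_eq_mul, eq_comm, QuotientGroup.eq, mul_assoc]

variable {B W : Type*} [Group W] {M : CoxeterMatrix B} (cs : CoxeterSystem M W)

/-- The double coset decomposition of `W/W_J × W/W_K` into orbits. -/
def orbitMap (J K : Set B) :
    (Σ d : doubleReps cs J K, W ⧸ parabolic cs (conjInter cs J K d)) →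
      (W ⧸ parabolic cs J) × (W ⧸ parabolic cs K) :=
  fun x => Quotient.liftOn' x.2
    (fun g => (QuotientGroup.mk (g * (x.1 : W)⁻¹), QuotientGroup.mk g)) fun g h hgh => by
      rw [QuotientGroup.leftRel_apply] at hgh
      refine Prod.ext (QuotientGroup.eq.2 ?_) (QuotientGroup.eq.2 ?_)
      · have := parabolic_mono cs conjInter_subset (conj_mem_parabolic_of_mem_conjInter hgh)
        simpa [mul_assoc] using this
      · exact parabolic_mono cs conjInter_subset hgh

theorem orbitMap_mk (J K : Set B) (d : doubleReps cs J K) (g : W) :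
    orbitMap cs J K ⟨d, (g : W ⧸ parabolic cs (conjInter cs J K d))⟩ =
      (QuotientGroup.mk (g * (d : W)⁻¹), QuotientGroup.mk g) := rfl

/-- Uniqueness of double coset representatives and Kilmoyer's theorem give injectivity; their
existence gives surjectivity. -/
theorem orbitMap_bijective (J K : Set B) : Function.Bijective (orbitMap cs J K) := by
  constructor
  · rintro ⟨⟨d, hd⟩, x⟩ ⟨⟨d', hd'⟩, y⟩ h
    induction x using QuotientGroup.induction_on with | H g => ?_
    induction y using QuotientGroup.induction_on with | H g' => ?_
    rw [orbitMap_mk, orbitMap_mk, Prod.mk.injEq, QuotientGroup.eq, QuotientGroup.eq] at h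
    obtain ⟨h1, h2⟩ := h
    obtain rfl : d' = d := by
      refine doubleReps_unique (a := ((g * d⁻¹)⁻¹ * (g' * d'⁻¹))⁻¹) (b := g⁻¹ * g') hd hd'
        (inv_mem h1) h2 ?_
      simp [mul_assoc]
    have : g⁻¹ * g' ∈ parabolic cs (conjInter cs J K d') :=
      mem_parabolic_conjInter hd h2 (by simpa [mul_assoc] using h1)
    rw [QuotientGroup.eq.2 this]
  · rintro ⟨x, y⟩
    induction x using QuotientGroup.induction_on with | H a => ?_
    induction y using QuotientGroup.induction_on with | H b => ?_
    obtain ⟨d, hd, j, hj, k, hk, e⟩ := exists_mul_doubleReps_mul (cs := cs) J K (a⁻¹ * b)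
    refine ⟨⟨⟨d, hd⟩, ((b * k⁻¹ : W) : W ⧸ parabolic cs (conjInter cs J K d))⟩, ?_⟩
    rw [orbitMap_mk]
    have hb : b = a * (j * d * k) := by rw [← e]; simp
    refine Prod.ext (QuotientGroup.eq.2 ?_) (QuotientGroup.eq.2 ?_)
    · rw [hb]
      simpa [mul_assoc] using hj
    · simpa using hk

theorem orbitMap_smul (J K : Set B) (w : W) (d : doubleReps cs J K)
    (x : W ⧸ parabolic cs (conjInter cs J K d)) :
    orbitMap cs J K ⟨d, w • x⟩ = w • orbitMap cs J K ⟨d, x⟩ := by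
  induction x using QuotientGroup.induction_on with | H g => ?_
  rw [MulAction.Quotient.smul_mk, orbitMap_mk, orbitMap_mk, Prod.smul_mk,
    MulAction.Quotient.smul_mk, MulAction.Quotient.smul_mk, smul_eq_mul, smul_eq_mul, mul_assoc]

open Classical in
/-- Mackey's formula for the permutation characters. -/
theorem permChar_mul_permChar (J K : Set B) [Fintype W] :
    permChar cs J * permChar cs K =
      ∑ d with d ∈ doubleReps cs J K, permChar cs (conjInter cs J K d) := by
  ext w
  rw [Pi.mul_apply, Finset.sum_apply]
  simp only [permChar]
  rw [← Nat.cast_mul, ← Nat.card_prod, ← Nat.cast_sum]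
  congr 1
  have e : (Σ d : doubleReps cs J K,
      MulAction.fixedBy (W ⧸ parabolic cs (conjInter cs J K d)) w) ≃
      MulAction.fixedBy (W ⧸ parabolic cs J) w × MulAction.fixedBy (W ⧸ parabolic cs K) w := by
    refine Equiv.ofBijective (fun x =>
      have h : w • orbitMap cs J K ⟨x.1, x.2⟩ = orbitMap cs J K ⟨x.1, x.2⟩ := by
        rw [← orbitMap_smul, x.2.2]
      (⟨_, congrArg Prod.fst h⟩, ⟨_, congrArg Prod.snd h⟩)) ⟨?_, ?_⟩
    · rintro ⟨d, x, hx⟩ ⟨d', x', hx'⟩ h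
      simp only [Prod.mk.injEq] at h
      have := (orbitMap_bijective cs J K).1
        (Prod.ext (congrArg Subtype.val h.1) (congrArg Subtype.val h.2))
      simp only [Sigma.mk.injEq] at this
      obtain ⟨rfl, h⟩ := this
      obtain rfl := eq_of_heq h
      rfl
    · rintro ⟨⟨y, hy⟩, ⟨z, hz⟩⟩
      obtain ⟨⟨d, x⟩, hx⟩ := (orbitMap_bijective cs J K).2 (y, z)
      have : w • x = x := by
        have h : orbitMap cs J K ⟨d, w • x⟩ = orbitMap cs J K ⟨d, x⟩ := by
          rw [orbitMap_smul, hx]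
          exact Prod.ext hy hz
        simpa using (orbitMap_bijective cs J K).1 h
      refine ⟨⟨d, x, this⟩, ?_⟩
      simp [hx]
  rw [← Nat.card_congr e, Nat.card_sigma, Finset.sum_subtype (p := (· ∈ doubleReps cs J K))]
  simp

end Mackey

/-! ### The geometric representation and parabolic rank -/

section Geometric

open Polynomial.Chebyshev in
/-- Two reflections whose Cartan numbers multiply to `4 cos² (π / m)` satisfy the braid relation. -/
theorem reflection_mul_reflection_pow_eq_one {V : Type*} [AddCommGroup V] [Module ℝ V]
    {x y : V} {f g : Module.Dual ℝ V} (hf : f x = 2) (hg : g y = 2) {m : ℕ} (hm : 3 ≤ m)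
    (h : f y * g x = 4 * Real.cos (Real.pi / m) ^ 2) :
    (Module.reflection hf * Module.reflection hg) ^ m = 1 := by
  set φ : ℝ := 2 * (Real.pi / m) with hφ
  have hm0 : (0 : ℝ) < m := by positivity
  have ht : 2 * Real.cos φ = f y * g x - 2 := by
    rw [h, hφ, Real.cos_two_mul]; ring
  have hsin : Real.sin φ ≠ 0 := by
    refine (Real.sin_pos_of_pos_of_lt_pi (by positivity) ?_).ne'
    rw [hφ, ← mul_div_assoc, div_lt_iff₀ hm0, mul_comm]
    have : (3 : ℝ) ≤ m := by exact_mod_cast hm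
    nlinarith [Real.pi_pos]
  have hS (n : ℤ) : (S ℝ n).eval (2 * Real.cos φ) = Real.sin ((n + 1) * φ) / Real.sin φ :=
    eq_div_of_mul_eq hsin (S_two_mul_real_cos φ n)
  ext z
  rw [Module.reflection_mul_reflection_pow_apply hf hg m z _ ht]
  -- Since mφ = 2π, the common factor is S_{k-1} = 0 from sin(kφ) = sin π if m = 2k, and S_k +
  -- S_{k-1} = 0 from (k+1)φ + kφ = 2π if m = 2k + 1.
  rcases Nat.even_or_odd' m with ⟨k, hk | hk⟩
  · have h1 : ((m : ℤ) - 2) / 2 = k - 1 := by omega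
    have h2 : ((m : ℤ) - 1) / 2 = k - 1 := by omega
    have h0 : (S ℝ ((k : ℤ) - 1)).eval (2 * Real.cos φ) = 0 := by
      rw [hS, div_eq_zero_iff]
      left
      rw [← Real.sin_pi, hφ]
      congr 1
      have : (m : ℝ) = 2 * k := by exact_mod_cast hk
      push_cast
      field_simp
      linarith
    rw [h1, h2, h0]
    simp
  · have h1 : ((m : ℤ) - 2) / 2 = k - 1 := by omega
    have h2 : ((m : ℤ) - 1) / 2 = k := by omega
    have h3 : ((m : ℤ) - 3) / 2 = k - 1 := by omega
    have h4 : (m : ℤ) / 2 = k := by omega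
    have h0 : (S ℝ (k : ℤ)).eval (2 * Real.cos φ) + (S ℝ ((k : ℤ) - 1)).eval (2 * Real.cos φ) =
        0 := by
      rw [hS, hS, ← add_div, div_eq_zero_iff]
      left
      have : ((((k : ℤ) - 1 : ℤ) : ℝ) + 1) * φ = 2 * Real.pi - (((k : ℤ) : ℝ) + 1) * φ := by
        have : (m : ℝ) = 2 * k + 1 := by exact_mod_cast hk
        rw [hφ]
        push_cast
        field_simp
        linarith
      rw [this, Real.sin_two_pi_sub, add_neg_cancel]
    rw [h1, h2, h3, h4, h0]
    simp

variable {B W : Type*} [Group W] (M : CoxeterMatrix B)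

/-- The simple coroots of the geometric representation, in the basis of simple roots. -/
def coroot (i : B) : Module.Dual ℝ (B →₀ ℝ) :=
  -- The entry 0, encoding infinite order, gives cos 0 = 1 through division by zero, hence the usual
  -- value -2.
  Finsupp.linearCombination ℝ fun j => -2 * Real.cos (Real.pi / M i j)

theorem coroot_single (i j : B) :
    coroot M i (Finsupp.single j 1) = -2 * Real.cos (Real.pi / M i j) := by
  simp [coroot]

theorem coroot_self (i : B) : coroot M i (Finsupp.single i 1) = 2 := by
  simp [coroot]

theorem reflection_isLiftable :
    M.IsLiftable fun i => Module.reflection (coroot_self M i) := by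
  intro i j
  by_cases hij : i = j
  · subst hij
    rw [M.diagonal, pow_one]
    ext z : 1
    exact Module.involutive_reflection (coroot_self M i) z
  by_cases h0 : M i j = 0
  · rw [h0, pow_zero]
  have h1 := M.off_diagonal i j hij
  by_cases h2 : M i j = 2
  · have e1 : coroot M i (Finsupp.single j 1) = 0 := by simp [coroot_single, h2]
    have e2 : coroot M j (Finsupp.single i 1) = 0 := by simp [coroot_single, M.symmetric j i, h2]
    rw [h2, pow_two]
    refine LinearEquiv.ext fun z => ?_
    simp only [LinearEquiv.mul_apply, Module.reflection_apply, map_sub, map_smul, e1, e2,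
      coroot_self, LinearEquiv.coe_one, id]
    module
  · refine reflection_mul_reflection_pow_eq_one _ _ (by omega) ?_
    rw [coroot_single, coroot_single, M.symmetric j i]
    ring

variable {M} (cs : CoxeterSystem M W)

/-- The geometric representation. -/
def geomRep : W →* ((B →₀ ℝ) ≃ₗ[ℝ] (B →₀ ℝ)) :=
  cs.lift ⟨_, reflection_isLiftable M⟩

theorem geomRep_simple (i : B) (v : B →₀ ℝ) :
    geomRep cs (cs.simple i) v = v - coroot M i v • Finsupp.single i 1 := by
  rw [geomRep, cs.lift_apply_simple, Module.reflection_apply]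

/-- s_i negates the simple root α_i, while s_j with j ≠ i preserves its i-th coordinate. -/
theorem simple_injective : Function.Injective cs.simple := by
  intro i j h
  by_contra hij
  have h1 := geomRep_simple cs i (Finsupp.single i 1)
  rw [h, geomRep_simple] at h1
  have := DFunLike.congr_fun h1 i
  simp [coroot_self, hij] at this
  linarith

theorem geomRep_simple_eq_self_iff (i : B) (v : B →₀ ℝ) :
    geomRep cs (cs.simple i) v = v ↔ coroot M i v = 0 := by
  rw [geomRep_simple, sub_eq_self, smul_eq_zero]
  simp

theorem geomRep_parabolic {J : Set B} {u : W} (hu : u ∈ parabolic cs J) {v : B →₀ ℝ}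
    (hv : ∀ i ∈ J, coroot M i v = 0) : geomRep cs u v = v := by
  induction hu using Subgroup.closure_induction with
  | mem x hx =>
    obtain ⟨i, hi, rfl⟩ := hx
    exact (geomRep_simple_eq_self_iff cs i v).2 (hv i hi)
  | one => simp
  | mul x y _ _ hx hy => rw [map_mul, LinearEquiv.mul_apply, hy, hx]
  | inv x _ hx => rw [map_inv, ← hx]; exact (geomRep cs x).symm_apply_apply v |>.trans hx.symm

theorem geomRep_wordProd_apply_of_not_mem (ω : List B) (v : B →₀ ℝ) {i : B} (hi : i ∉ ω) :
    geomRep cs (cs.wordProd ω) v i = v i := by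
  induction ω with
  | nil => simp
  | cons j ω ih =>
    simp only [List.mem_cons, not_or] at hi
    rw [cs.wordProd_cons, map_mul, LinearEquiv.mul_apply, geomRep_simple]
    simp [ih hi.2, Ne.symm hi.1]

/-- Only the first letter can change its own coordinate, so if the product fixes v that letter fixes
v, and so does the rest of the word. -/
theorem coroot_eq_zero_of_wordProd_fixed (ω : List B) (hω : ω.Nodup) {v : B →₀ ℝ}
    (h : geomRep cs (cs.wordProd ω) v = v) : ∀ i ∈ ω, coroot M i v = 0 := by
  induction ω with
  | nil => simp
  | cons j ω ih =>
    rw [List.nodup_cons] at hω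
    rw [cs.wordProd_cons, map_mul, LinearEquiv.mul_apply] at h
    have h' : geomRep cs (cs.wordProd ω) v = geomRep cs (cs.simple j) v := by
      have := congrArg (geomRep cs (cs.simple j)) h
      rwa [← LinearEquiv.mul_apply, ← map_mul, cs.simple_mul_simple_self, map_one,
        LinearEquiv.coe_one, id] at this
    have h0 : coroot M j v = 0 := by
      have := geomRep_wordProd_apply_of_not_mem cs ω v hω.1
      rw [h', geomRep_simple] at this
      simpa using this
    intro i hi
    rcases List.mem_cons.1 hi with rfl | hi
    · exact h0
    · exact ih hω.2 (h'.trans ((geomRep_simple_eq_self_iff cs j v).2 h0)) i hi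

variable [Fintype W] [Fintype B]

/-- An invariant inner product on the geometric representation. -/
def invForm : LinearMap.BilinForm ℝ (B →₀ ℝ) :=
  ∑ g : W, ∑ b : B, (LinearMap.mul ℝ ℝ).compl₁₂
    (Finsupp.lapply b ∘ₗ (geomRep cs g).toLinearMap)
    (Finsupp.lapply b ∘ₗ (geomRep cs g).toLinearMap)

theorem invForm_apply (v w : B →₀ ℝ) :
    invForm cs v w = ∑ g : W, ∑ b : B, geomRep cs g v b * geomRep cs g w b := by
  simp [invForm, LinearMap.sum_apply]

theorem invForm_geomRep (u : W) (v w : B →₀ ℝ) :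
    invForm cs (geomRep cs u v) (geomRep cs u w) = invForm cs v w := by
  simp only [invForm_apply, ← LinearEquiv.mul_apply, ← map_mul]
  exact Fintype.sum_equiv (Equiv.mulRight u) _ _ fun g => rfl

theorem eq_zero_of_invForm_self {v : B →₀ ℝ} (h : invForm cs v v = 0) : v = 0 := by
  rw [invForm_apply, Finset.sum_eq_zero_iff_of_nonneg fun g _ =>
    Finset.sum_nonneg fun b _ => mul_self_nonneg _] at h
  have := h 1 (Finset.mem_univ _)
  rw [Finset.sum_eq_zero_iff_of_nonneg fun b _ => mul_self_nonneg _] at this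
  ext b
  simpa using this b (Finset.mem_univ _)

/-- The isometry s_i negates α_i, which forces 2⟨α_i, v⟩ = α_i^∨(v)⟨α_i, α_i⟩. -/
theorem invForm_single_eq_zero_iff (i : B) (v : B →₀ ℝ) :
    invForm cs (Finsupp.single i 1) v = 0 ↔ coroot M i v = 0 := by
  have hα : geomRep cs (cs.simple i) (Finsupp.single i 1) = -Finsupp.single i 1 := by
    rw [geomRep_simple, coroot_self]; module
  have h1 := invForm_geomRep cs (cs.simple i) (Finsupp.single i 1) v
  rw [hα, geomRep_simple] at h1
  simp only [map_neg, map_sub, map_smul, LinearMap.neg_apply, smul_eq_mul] at h1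
  have h2 : invForm cs (Finsupp.single i 1) (Finsupp.single i 1) ≠ 0 := fun h => by
    simpa using eq_zero_of_invForm_self cs h
  have h3 : 2 * invForm cs (Finsupp.single i 1) v =
      coroot M i v * invForm cs (Finsupp.single i 1) (Finsupp.single i 1) := by linarith
  constructor
  · intro h
    rw [h, mul_zero, zero_eq_mul] at h3
    exact h3.resolve_right h2
  · intro h
    rw [h, zero_mul] at h3
    linarith

/-- The common kernel of the coroots in `J`. -/
def fixedSpace (J : Set B) : Submodule ℝ (B →₀ ℝ) :=
  (invForm cs).orthogonal (Finsupp.supported ℝ ℝ J)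

theorem mem_fixedSpace {J : Set B} {v : B →₀ ℝ} :
    v ∈ fixedSpace cs J ↔ ∀ i ∈ J, coroot M i v = 0 := by
  rw [fixedSpace, LinearMap.BilinForm.mem_orthogonal_iff]
  simp only [← invForm_single_eq_zero_iff cs]
  refine ⟨fun h i hi => h _ (Finsupp.single_mem_supported ℝ 1 hi), fun h x hx => ?_⟩
  rw [Finsupp.supported_eq_span_single] at hx
  induction hx using Submodule.span_induction with
  | mem x hx => obtain ⟨i, hi, rfl⟩ := hx; exact h i hi
  | zero => simp
  | add x y _ _ hx hy => simp [hx, hy]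
  | smul a x _ hx => simp [hx]

theorem finrank_fixedSpace_add (J : Set B) :
    Module.finrank ℝ (fixedSpace cs J) + J.ncard = Fintype.card B := by
  classical
  have hnd : (invForm cs).Nondegenerate :=
    ⟨fun x h => eq_zero_of_invForm_self cs (h x),
      fun x h => eq_zero_of_invForm_self cs (h x)⟩
  have := LinearMap.BilinForm.finrank_orthogonal hnd
    (Finsupp.supported ℝ ℝ J)
  have h1 : Module.finrank ℝ (Finsupp.supported ℝ ℝ J) = J.ncard := by
    rw [(Finsupp.supportedEquivFinsupp (M := ℝ) (R := ℝ) J).finrank_eq,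
      Module.finrank_finsupp_self, Set.ncard_eq_toFinset_card', Set.toFinset_card]
  have h2 : J.ncard ≤ Fintype.card B := by
    rw [← Nat.card_eq_fintype_card]; exact Set.ncard_le_card J
  rw [h1, Module.finrank_finsupp_self] at this
  rw [fixedSpace, this]
  omega

/-- The product of distinct simple reflections is not conjugate into a parabolic subgroup of
smaller rank. -/
theorem length_le_ncard_of_conj_mem {ω : List B} (hω : ω.Nodup) {L : Set B} {g : W}
    (h : g⁻¹ * cs.wordProd ω * g ∈ parabolic cs L) : ω.length ≤ L.ncard := by
  classical
  -- g carries vectors fixed by W_L to vectors fixed by the word. These spaces have codimensions |L|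
  -- and |ω|.
  have hle : (fixedSpace cs L).map (geomRep cs g).toLinearMap ≤ fixedSpace cs {i | i ∈ ω} := by
    rintro _ ⟨v, hv, rfl⟩
    rw [mem_fixedSpace]
    refine coroot_eq_zero_of_wordProd_fixed cs ω hω ?_
    have := geomRep_parabolic cs h ((mem_fixedSpace cs).1 hv)
    have h2 := congrArg (geomRep cs g) this
    rw [← LinearEquiv.mul_apply, ← map_mul] at h2
    simpa [mul_assoc] using h2
  have h1 := Submodule.finrank_mono hle
  rw [LinearEquiv.finrank_map_eq] at h1
  have h2 := finrank_fixedSpace_add cs L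
  have h3 := finrank_fixedSpace_add cs {i | i ∈ ω}
  have h4 : ({i | i ∈ ω} : Set B).ncard = ω.length := by
    rw [← List.toFinset_card_of_nodup hω, ← Set.ncard_coe_finset, List.coe_toFinset]
  omega

end Geometric

/-! ### Fixed points on cosets and normalizers -/

section FixedPoints

variable {G : Type*} [Group G]

/-- The elements that conjugate `w` into `H`. -/
def conjugators (H : Subgroup G) (w : G) : Set G := {g | g⁻¹ * w * g ∈ H}

theorem card_fixedBy_mul_card (H : Subgroup G) (w : G) :
    Nat.card H * Nat.card (MulAction.fixedBy (G ⧸ H) w) = Nat.card (conjugators H w) := by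
  rw [← Nat.card_prod, ← Nat.card_congr
    (QuotientGroup.preimageMkEquivSubgroupProdSet H (MulAction.fixedBy (G ⧸ H) w))]
  congr! 2
  ext g
  exact smul_mk_eq_mk_iff H w g

theorem card_dvd_card_of_mul_mem (H : Subgroup G) {A : Set G}
    (hA : ∀ a ∈ A, ∀ h ∈ H, a * h ∈ A) : Nat.card H ∣ Nat.card A := by
  have e : QuotientGroup.mk ⁻¹' ((QuotientGroup.mk : G → G ⧸ H) '' A) = A := by
    refine Set.Subset.antisymm ?_ (Set.subset_preimage_image _ _)
    rintro g ⟨a, ha, h⟩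
    simpa using hA a ha _ (QuotientGroup.eq.1 h)
  have := Nat.card_congr (QuotientGroup.preimageMkEquivSubgroupProdSet H
    ((QuotientGroup.mk : G → G ⧸ H) '' A))
  rw [e, Nat.card_prod] at this
  exact Dvd.intro _ this.symm

theorem card_mul_relIndex_normalizer (H : Subgroup G) :
    Nat.card H * H.relIndex (Subgroup.normalizer (H : Set G)) =
      Nat.card (Subgroup.normalizer (H : Set G)) := by
  have := Subgroup.relIndex_mul_relIndex ⊥ H (Subgroup.normalizer (H : Set G)) bot_le
    Subgroup.le_normalizer
  simpa [Subgroup.relIndex_bot_left] using this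

/-- The elements conjugating w into H form a set stable under right multiplication by N(H), of size
|H| times the number of fixed cosets; cancel |H|. -/
theorem relIndex_normalizer_dvd_card_fixedBy [Finite G] (H : Subgroup G) (w : G) :
    H.relIndex (Subgroup.normalizer (H : Set G)) ∣ Nat.card (MulAction.fixedBy (G ⧸ H) w) := by
  have h : Nat.card (Subgroup.normalizer (H : Set G)) ∣ Nat.card (conjugators H w) := by
    refine card_dvd_card_of_mul_mem _ fun a ha n hn => ?_
    have := (Subgroup.mem_normalizer_iff''.1 hn (a⁻¹ * w * a)).1 ha
    simpa [conjugators, mul_assoc] using this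
  rw [← card_fixedBy_mul_card, ← card_mul_relIndex_normalizer] at h
  exact Nat.dvd_of_mul_dvd_mul_left Nat.card_pos h

end FixedPoints

/-! ### Permutation characters at parabolic Coxeter elements -/

section Characters

variable {B W : Type*} [Group W] [Finite W] {M : CoxeterMatrix B} (cs : CoxeterSystem M W)

include cs in
theorem finite_index : Finite B := Finite.of_injective _ (simple_injective cs)

omit [Finite W] in
theorem card_mul_permChar (J : Set B) (w : W) :
    (Nat.card (parabolic cs J) : ℤ) * permChar cs J w =
      Nat.card (conjugators (parabolic cs J) w) := by
  rw [permChar, ← Nat.cast_mul, card_fixedBy_mul_card]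

omit [Finite W] in
theorem parabolic_of_image_conj {J K : Set B} {u : W}
    (h : MulAut.conj u '' simples cs J = simples cs K) (x : W) :
    x ∈ parabolic cs J ↔ u * x * u⁻¹ ∈ parabolic cs K := by
  have : parabolic cs K = (parabolic cs J).map (MulAut.conj u).toMonoidHom := by
    rw [parabolic, parabolic, MonoidHom.map_closure, ← h]
    rfl
  rw [this, Subgroup.mem_map_equiv]
  simp [mul_assoc]

theorem permChar_eq_of_conjSubsets {J K : Set B} (h : ConjSubsets cs J K) :
    permChar cs J = permChar cs K := by
  obtain ⟨u, hu⟩ := h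
  have hmem := parabolic_of_image_conj cs hu
  ext w
  have h1 : Nat.card (parabolic cs J) = Nat.card (parabolic cs K) := by
    refine Nat.card_congr ((MulAut.conj u).toEquiv.subtypeEquiv fun x => ?_)
    simpa using hmem x
  have h2 : Nat.card (conjugators (parabolic cs J) w) =
      Nat.card (conjugators (parabolic cs K) w) := by
    refine Nat.card_congr ((Equiv.mulRight u⁻¹).subtypeEquiv fun g => ?_)
    simpa [conjugators, mul_assoc] using hmem (g⁻¹ * w * g)
  have h3 := card_mul_permChar cs J w
  rw [h1, h2, ← card_mul_permChar] at h3
  exact mul_left_cancel₀ (by exact_mod_cast Nat.card_pos.ne') h3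

/-- A parabolic Coxeter element. -/
def coxeterElt (K : Set B) : W :=
  haveI := finite_index cs
  cs.wordProd (Set.toFinite K).toFinset.toList

theorem coxeterElt_mem (K : Set B) : coxeterElt cs K ∈ parabolic cs K :=
  wordProd_mem_parabolic cs (by simp)

theorem ncard_le_of_conj_mem {K L : Set B} {g : W}
    (h : g⁻¹ * coxeterElt cs K * g ∈ parabolic cs L) : K.ncard ≤ L.ncard := by
  have := finite_index cs
  have := Fintype.ofFinite B
  have := Fintype.ofFinite W
  have := length_le_ncard_of_conj_mem cs (Finset.nodup_toList _) h
  rwa [Finset.length_toList, ← Set.ncard_eq_toFinset_card] at this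

theorem permChar_coxeterElt_eq_zero {K L : Set B} (h : L.ncard < K.ncard) :
    permChar cs L (coxeterElt cs K) = 0 := by
  rw [permChar, Nat.cast_eq_zero, Nat.card_eq_zero]
  left
  refine ⟨fun ⟨x, hx⟩ => ?_⟩
  induction x using QuotientGroup.induction_on with | H g => ?_
  rw [MulAction.mem_fixedBy, smul_mk_eq_mk_iff] at hx
  exact h.not_ge (ncard_le_of_conj_mem cs hx)

/-- With g⁻¹ = adb, Kilmoyer's theorem puts a conjugate of c_K in the parabolic subgroup of d⁻¹Kd ∩
K. The rank bound makes this set all of K, so d normalizes W_K. -/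
theorem conj_coxeterElt_mem_iff {K : Set B} {g : W} :
    g⁻¹ * coxeterElt cs K * g ∈ parabolic cs K ↔
      g ∈ Subgroup.normalizer (parabolic cs K : Set W) := by
  have := finite_index cs
  constructor
  · intro h
    obtain ⟨d, hd, a, ha, b, hb, e⟩ := exists_mul_doubleReps_mul (cs := cs) K K g⁻¹
    have hg : g = b⁻¹ * d⁻¹ * a⁻¹ := by rw [← inv_inv g, e]; simp [mul_assoc]
    have h1 : d * (b * coxeterElt cs K * b⁻¹) * d⁻¹ ∈ parabolic cs K := by
      have := mul_mem (mul_mem (inv_mem ha) h) ha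
      rw [hg] at this
      simpa [mul_assoc] using this
    have h2 := mem_parabolic_conjInter hd (mul_mem (mul_mem hb (coxeterElt_mem cs K))
      (inv_mem hb)) h1
    have h3 : conjInter cs K K d = K := Set.eq_of_subset_of_ncard_le conjInter_subset
      (ncard_le_of_conj_mem cs (g := b⁻¹) (by simpa using h2))
    have h4 : d ∈ Subgroup.normalizer (parabolic cs K : Set W) := by
      refine Subgroup.mem_normalizer_fintype fun y hy => ?_
      have hy' : y ∈ parabolic cs (conjInter cs K K d) := by rwa [h3]
      exact parabolic_mono cs conjInter_subset (conj_mem_parabolic_of_mem_conjInter hy')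
    rw [hg]
    have hle := Subgroup.le_normalizer (H := parabolic cs K)
    exact mul_mem (mul_mem (hle (inv_mem hb)) (inv_mem h4)) (hle (inv_mem ha))
  · intro h
    exact (Subgroup.mem_normalizer_iff''.1 h _).1 (coxeterElt_mem cs K)

theorem permChar_coxeterElt_self (K : Set B) : permChar cs K (coxeterElt cs K) =
    (parabolic cs K).relIndex (Subgroup.normalizer (parabolic cs K : Set W)) := by
  have h := card_mul_permChar cs K (coxeterElt cs K)
  have h2 : conjugators (parabolic cs K) (coxeterElt cs K) =
      Subgroup.normalizer (parabolic cs K : Set W) := by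
    ext g
    exact conj_coxeterElt_mem_iff cs
  rw [h2] at h
  have h3 := card_mul_relIndex_normalizer (parabolic cs K)
  refine mul_left_cancel₀ (a := (Nat.card (parabolic cs K) : ℤ))
    (by exact_mod_cast Nat.card_pos.ne') (h.trans ?_)
  exact_mod_cast h3.symm

theorem permChar_coxeterElt_self_ne_zero (K : Set B) : permChar cs K (coxeterElt cs K) ≠ 0 := by
  rw [permChar_coxeterElt_self, Nat.cast_ne_zero]
  exact Subgroup.index_ne_zero_of_finite

open Classical in
-- Evaluate Mackey's formula at c_K: terms with a proper subset of K vanish, and the nonzero factor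
-- χ_K(c_K) cancels.
theorem permChar_coxeterElt [Fintype W] (J K : Set B) : permChar cs J (coxeterElt cs K) =
    (Finset.univ.filter fun d => d ∈ doubleReps cs J K ∧ conjInter cs J K d = K).card := by
  have := finite_index cs
  have h := congrFun (permChar_mul_permChar cs J K) (coxeterElt cs K)
  rw [Pi.mul_apply, Finset.sum_apply] at h
  have h1 : ∀ d, permChar cs (conjInter cs J K d) (coxeterElt cs K) =
      if conjInter cs J K d = K then permChar cs K (coxeterElt cs K) else 0 := by
    intro d
    split_ifs with hd
    · rw [hd]
    · exact permChar_coxeterElt_eq_zero cs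
        (Set.ncard_lt_ncard (conjInter_subset.ssubset_of_ne hd))
  simp only [h1] at h
  rw [← Finset.sum_filter, Finset.sum_const, Finset.filter_filter, nsmul_eq_mul] at h
  exact mul_right_cancel₀ (permChar_coxeterElt_self_ne_zero cs K) h

theorem conjSubsets_of_permChar_ne_zero {J K : Set B} (hJK : J.ncard ≤ K.ncard)
    (h : permChar cs J (coxeterElt cs K) ≠ 0) : ConjSubsets cs J K := by
  classical
  have := finite_index cs
  have := Fintype.ofFinite W
  rw [permChar_coxeterElt, Nat.cast_ne_zero, Finset.card_ne_zero] at h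
  obtain ⟨d, hd⟩ := h
  simp only [Finset.mem_filter, Finset.mem_univ, true_and] at hd
  have hsub : MulAut.conj d '' simples cs K ⊆ simples cs J := by
    rintro _ ⟨_, ⟨k, hk, rfl⟩, rfl⟩
    rw [← hd.2] at hk
    obtain ⟨j, hj, e⟩ := hk.2
    exact ⟨j, hj, e.symm⟩
  have heq : MulAut.conj d '' simples cs K = simples cs J := by
    refine Set.eq_of_subset_of_ncard_le hsub ?_
    rw [Set.ncard_image_of_injective _ (MulAut.conj d).injective, simples, simples,
      Set.ncard_image_of_injective _ (simple_injective cs),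
      Set.ncard_image_of_injective _ (simple_injective cs)]
    exact hJK
  refine ⟨d⁻¹, ?_⟩
  rw [← heq, ← Set.image_comp]
  convert Set.image_id _
  ext x
  simp [mul_assoc]

omit [Finite W] in
theorem conjSubsets_equivalence : Equivalence (ConjSubsets cs) where
  refl J := ⟨1, by simp⟩
  symm := by
    rintro J K ⟨u, h⟩
    refine ⟨u⁻¹, ?_⟩
    rw [← h, ← Set.image_comp]
    convert Set.image_id _
    ext x
    simp [mul_assoc]
  trans := by
    rintro J K L ⟨u, h⟩ ⟨v, h'⟩
    refine ⟨v * u, ?_⟩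
    rw [← h', ← h, ← Set.image_comp]
    congr 1
    ext x
    simp [mul_assoc]

end Characters

/-! ### Linear independence of the x_J -/

section Independence

variable {B W : Type*} [Group W] [Finite W] {M : CoxeterMatrix B} (cs : CoxeterSystem M W)

/-- Every subset of the simple reflections is the descent set of some element. -/
theorem exists_descents_eq (K : Set B) : ∃ w : W, ∀ i, cs.simple i ∈ invSet cs w ↔ i ∈ K := by
  -- The longest element of W_K works.
  obtain ⟨⟨w, hw⟩, hmax⟩ := Finite.exists_max fun v : parabolic cs K => cs.length (v : W)
  refine ⟨w, fun i => ⟨fun h => ?_, fun h => ?_⟩⟩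
  · obtain ⟨j, hj, e⟩ := exists_mem_of_simple_mem_parabolic cs (invSet_subset_parabolic cs hw h)
    rwa [simple_injective cs e]
  · by_contra hi
    have h1 := length_mul_simple_of_not_mem cs hi
    have := hmax ⟨w * cs.simple i, mul_mem hw (simple_mem_parabolic cs h)⟩
    simp only at this
    omega

open Classical in
theorem coeff_xElt (J : Set B) (w : W) :
    (xElt cs J).coeff w = if w ∈ minimalReps cs J then 1 else 0 := by
  have := Fintype.ofFinite W
  rw [coe_xElt_eq_sum, MonoidAlgebra.coeff_sum, Finsupp.finsetSum_apply]
  simp [Finsupp.single_apply]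

/-- At an element with descent set Kᶜ, x_J has coefficient 1 exactly when J ⊆ K; this system is
unitriangular for inclusion. -/
theorem linearIndependent_xElt : LinearIndependent ℤ (xElt cs) := by
  classical
  have := finite_index cs
  have := Fintype.ofFinite B
  rw [Fintype.linearIndependent_iff]
  intro g hg
  have key : ∀ K : Set B, ∑ J with J ⊆ K, g J = 0 := by
    intro K
    obtain ⟨w, hw⟩ := exists_descents_eq cs Kᶜ
    have h := congrArg (fun x => x.coeff w) hg
    simp only [MonoidAlgebra.coeff_sum, Finsupp.finsetSum_apply, MonoidAlgebra.coeff_smul,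
      Finsupp.smul_apply, coeff_xElt, MonoidAlgebra.coeff_zero, Finsupp.zero_apply] at h
    rw [Finset.sum_filter]
    refine (Finset.sum_congr rfl fun J _ => ?_).trans h
    have : w ∈ minimalReps cs J ↔ J ⊆ K := by
      rw [mem_minimalReps_iff]
      simp only [hw, Set.mem_compl_iff, not_not]
      rfl
    simp [this]
  intro K
  induction hn : K.ncard using Nat.strong_induction_on generalizing K with
  | _ n ih =>
    have h := key K
    rw [Finset.sum_eq_single_of_mem K (by simp)] at h
    · exact h
    · intro J hJ hne
      exact ih _ (hn ▸ Set.ncard_lt_ncard ((Finset.mem_filter.1 hJ).2.ssubset_of_ne hne)) J rfl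

end Independence

/-! ### The integral descent ring and θ -/

section IntegralRing

variable {B W : Type*} [Group W] [Finite W] {M : CoxeterMatrix B} (cs : CoxeterSystem M W)

omit [Finite W] in
theorem parabolic_univ : parabolic cs Set.univ = ⊤ := by
  rw [parabolic, simples, Set.image_univ, cs.subgroup_closure_range_simple]

omit [Finite W] in
theorem minimalReps_univ : minimalReps cs Set.univ = {1} := by
  ext w
  refine ⟨fun h => ?_, ?_⟩
  · have := h w⁻¹ (by simp [parabolic_univ])
    simpa [cs.length_eq_zero_iff] using this
  · rintro rfl u -
    simp

theorem xElt_univ : xElt cs Set.univ = 1 := by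
  have h : (Set.toFinite (minimalReps cs Set.univ)).toFinset = {1} := by
    ext
    simp [minimalReps_univ]
  rw [xElt, h, Finset.sum_singleton, map_one]

omit [Finite W] in
theorem permChar_univ : permChar cs Set.univ = 1 := by
  ext w
  have : Subsingleton (W ⧸ parabolic cs Set.univ) := by
    rw [parabolic_univ]
    exact QuotientGroup.subsingleton_quotient_top
  rw [permChar, Pi.one_apply, Nat.cast_eq_one, Nat.card_eq_one_iff_unique]
  refine ⟨inferInstance, ⟨⟨QuotientGroup.mk 1, Subsingleton.elim _ _⟩⟩⟩

/-- Solomon's theorem. -/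
theorem toSubmodule_integralDescentRing : Subalgebra.toSubmodule (integralDescentRing cs) =
    Submodule.span ℤ (Set.range (xElt cs)) := by
  classical
  have := Fintype.ofFinite W
  refine le_antisymm ?_ (Algebra.span_le_adjoin ℤ _)
  have hone : (1 : MonoidAlgebra ℤ W) ∈ Submodule.span ℤ (Set.range (xElt cs)) :=
    Submodule.subset_span ⟨Set.univ, xElt_univ cs⟩
  have hmul : ∀ x y, x ∈ Submodule.span ℤ (Set.range (xElt cs)) →
      y ∈ Submodule.span ℤ (Set.range (xElt cs)) →
      x * y ∈ Submodule.span ℤ (Set.range (xElt cs)) := by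
    intro x y hx hy
    have := Submodule.mul_mem_mul hx hy
    rw [Submodule.span_mul_span] at this
    refine (Submodule.span_le.2 ?_) this
    rintro _ ⟨_, ⟨J, rfl⟩, _, ⟨K, rfl⟩, rfl⟩
    simp only [xElt_mul_xElt]
    exact Submodule.sum_mem _ fun d _ => Submodule.subset_span ⟨_, rfl⟩
  exact Algebra.adjoin_le (S := (Submodule.span ℤ (Set.range (xElt cs))).toSubalgebra hone hmul)
    Submodule.subset_span

theorem xInt_linearIndependent : LinearIndependent ℤ (xInt cs) :=
  LinearIndependent.of_comp (Subalgebra.val (integralDescentRing cs)).toLinearMap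
    (linearIndependent_xElt cs)

theorem span_xInt : ⊤ ≤ Submodule.span ℤ (Set.range (xInt cs)) := by
  rintro ⟨x, hx⟩ -
  have h : x ∈ Submodule.span ℤ (Set.range (xElt cs)) := by
    rw [← toSubmodule_integralDescentRing]; exact hx
  have e : Set.range (xElt cs) =
      (Subalgebra.val (integralDescentRing cs)).toLinearMap '' Set.range (xInt cs) := by
    rw [← Set.range_comp]; rfl
  rw [e, Submodule.span_image] at h
  obtain ⟨y, hy, rfl⟩ := h
  exact hy

/-- The basis of the descent ring formed by the elements `x_J`. -/
def xBasis : Module.Basis (Set B) ℤ (integralDescentRing cs) :=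
  Module.Basis.mk (xInt_linearIndependent cs) (span_xInt cs)

theorem xBasis_apply (J : Set B) : xBasis cs J = xInt cs J := by
  simp [xBasis]

open Classical in
theorem xInt_mul_xInt [Fintype W] (J K : Set B) : xInt cs J * xInt cs K =
    ∑ d with d ∈ doubleReps cs J K, xInt cs (conjInter cs J K d) := by
  apply Subtype.ext
  simpa [xInt] using xElt_mul_xElt cs J K

/-- The linear map sending `x_J` to the permutation character `χ_J`. -/
def charLinear : integralDescentRing cs →ₗ[ℤ] (W → ℤ) :=
  (xBasis cs).constr ℤ (permChar cs)

theorem charLinear_xInt (J : Set B) : charLinear cs (xInt cs J) = permChar cs J := by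
  rw [← xBasis_apply, charLinear, Module.Basis.constr_basis]

/-- The homomorphism sending `x_J` to the permutation character `χ_J`. -/
def charHom : integralDescentRing cs →ₐ[ℤ] (W → ℤ) :=
  AlgHom.ofLinearMap (charLinear cs)
    (by
      have : (1 : integralDescentRing cs) = xInt cs Set.univ :=
        Subtype.ext (xElt_univ cs).symm
      rw [this, charLinear_xInt, permChar_univ])
    (by
      classical
      have := Fintype.ofFinite W
      -- On basis elements, Solomon's rule and Mackey's formula have the same structure constants.
      rw [LinearMap.map_mul_iff]
      refine (xBasis cs).ext fun J => (xBasis cs).ext fun K => ?_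
      simp [xBasis_apply, charLinear_xInt, xInt_mul_xInt, permChar_mul_permChar])

theorem charHom_xInt (J : Set B) : charHom cs (xInt cs J) = permChar cs J :=
  charLinear_xInt cs J

/-- For x = x_J, the d with d⁻¹Jd ∩ K = K contribute χ_J(c_K) copies of x_K; all other terms have
smaller rank. -/
theorem mul_xInt_sub_mem (x : integralDescentRing cs) (K : Set B) :
    x * xInt cs K - charHom cs x (coxeterElt cs K) • xInt cs K ∈
      Submodule.span ℤ (xInt cs '' {L | L.ncard < K.ncard}) := by
  classical
  have := finite_index cs
  have := Fintype.ofFinite W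
  induction span_xInt cs (Submodule.mem_top (x := x)) using Submodule.span_induction with
  | mem x hx =>
    obtain ⟨J, rfl⟩ := hx
    rw [charHom_xInt, permChar_coxeterElt, xInt_mul_xInt,
      ← Finset.sum_filter_add_sum_filter_not _ fun d => conjInter cs J K d = K]
    have h : ∑ d with d ∈ doubleReps cs J K ∧ conjInter cs J K d = K,
        xInt cs (conjInter cs J K d) =
        ((Finset.univ.filter fun d => d ∈ doubleReps cs J K ∧
          conjInter cs J K d = K).card : ℤ) • xInt cs K := by
      rw [Finset.sum_congr rfl fun d hd => by rw [(Finset.mem_filter.1 hd).2.2],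
        Finset.sum_const, natCast_zsmul]
    rw [Finset.filter_filter, h, add_sub_cancel_left]
    refine Submodule.sum_mem _ fun d hd => Submodule.subset_span ⟨_, ?_, rfl⟩
    exact Set.ncard_lt_ncard (conjInter_subset.ssubset_of_ne (Finset.mem_filter.1 hd).2)
  | zero => simp
  | add x y _ _ hx hy =>
    convert Submodule.add_mem _ hx hy using 1
    rw [map_add, Pi.add_apply, add_smul, add_mul]
    abel
  | smul a x _ hx =>
    convert Submodule.smul_mem _ a hx using 1
    rw [map_smul, Pi.smul_apply, smul_sub, smul_mul_assoc, smul_assoc]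

end IntegralRing

/-! ### Reduction modulo p and the radical -/

section Modular

variable {B W : Type*} [Group W] [Finite W] {M : CoxeterMatrix B} (cs : CoxeterSystem M W)
  (p : ℕ)

/-- The ring homomorphism reducing characters modulo `p`. -/
def charModHom : integralDescentRing cs →+* (W → ZMod p) :=
  ((Int.castRingHom (ZMod p)).compLeft W).comp (charHom cs).toRingHom

/-- The homomorphism from the modular descent algebra induced by `charModHom`. -/
def modCharRingHom : ModularDescentAlgebra cs p →+* (W → ZMod p) :=
  Ideal.Quotient.lift (pIdeal cs p) (charModHom cs p) fun x hx => by
    obtain ⟨c, rfl⟩ := Ideal.mem_span_singleton'.1 hx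
    rw [map_mul, map_natCast]
    have : (p : W → ZMod p) = 0 := by ext; simp
    rw [this, mul_zero]

/-- The homomorphism `φ` from the modular descent algebra to functions modulo `p`. -/
def modCharHom : ModularDescentAlgebra cs p →ₐ[ZMod p] (W → ZMod p) :=
  { modCharRingHom cs p with
    commutes' := RingHom.congr_fun (Subsingleton.elim
      ((modCharRingHom cs p).comp (algebraMap (ZMod p) (ModularDescentAlgebra cs p)))
      (algebraMap (ZMod p) (W → ZMod p))) }

theorem modCharHom_reduction (x : integralDescentRing cs) (w : W) :
    modCharHom cs p (reduction cs p x) w = ((charHom cs x w : ℤ) : ZMod p) := rfl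

theorem modCharHom_xBar (J : Set B) (w : W) :
    modCharHom cs p (xBar cs p J) w = ((permChar cs J w : ℤ) : ZMod p) := by
  rw [xBar, modCharHom_reduction, charHom_xInt]

theorem reduction_zsmul (n : ℤ) (x : integralDescentRing cs) :
    reduction cs p (n • x) = (n : ZMod p) • reduction cs p x := by
  rw [map_zsmul, Int.cast_smul_eq_zsmul]

theorem reduction_mem_span {S : Set (Set B)} {x : integralDescentRing cs}
    (hx : x ∈ Submodule.span ℤ (xInt cs '' S)) :
    reduction cs p x ∈ Submodule.span (ZMod p) (xBar cs p '' S) := by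
  induction hx using Submodule.span_induction with
  | mem x hx => obtain ⟨J, hJ, rfl⟩ := hx; exact Submodule.subset_span ⟨J, hJ, rfl⟩
  | zero => simp
  | add x y _ _ hx hy => rw [map_add]; exact add_mem hx hy
  | smul a x _ hx => rw [reduction_zsmul]; exact Submodule.smul_mem _ _ hx

theorem mem_span_xBar (y : ModularDescentAlgebra cs p) :
    y ∈ Submodule.span (ZMod p) (xBar cs p '' Set.univ) := by
  obtain ⟨x, rfl⟩ := Ideal.Quotient.mk_surjective y
  exact reduction_mem_span cs p (by rw [Set.image_univ]; exact span_xInt cs Submodule.mem_top)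

/-- The span of the `x_J` with `J` of cardinality less than `n`. -/
def rankFiltration (n : ℕ) : Submodule (ZMod p) (ModularDescentAlgebra cs p) :=
  Submodule.span (ZMod p) (xBar cs p '' {L | L.ncard < n})

/-- The diagonal coefficients of multiplication by y are values of φ(y), hence zero. -/
theorem mul_mem_rankFiltration {y v : ModularDescentAlgebra cs p}
    (hy : modCharHom cs p y = 0) {n : ℕ} (hv : v ∈ rankFiltration cs p (n + 1)) :
    y * v ∈ rankFiltration cs p n := by
  induction hv using Submodule.span_induction with
  | mem v hv =>
    obtain ⟨K, hK, rfl⟩ := hv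
    obtain ⟨x, rfl⟩ := Ideal.Quotient.mk_surjective y
    have h := reduction_mem_span cs p (mul_xInt_sub_mem cs x K)
    have h0 : ((charHom cs x (coxeterElt cs K) : ℤ) : ZMod p) = 0 := by
      rw [← modCharHom_reduction]
      exact congrFun hy _
    rw [map_sub, map_mul, reduction_zsmul, h0, zero_smul, sub_zero] at h
    exact Submodule.span_mono (Set.image_mono fun L hL =>
      lt_of_lt_of_le hL (Nat.lt_succ_iff.1 hK)) h
  | zero => simp
  | add u v _ _ hu hv => rw [mul_add]; exact add_mem hu hv
  | smul a v _ hv => rw [mul_smul_comm]; exact Submodule.smul_mem _ _ hv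

theorem isNilpotent_of_modCharHom_eq_zero {y : ModularDescentAlgebra cs p}
    (hy : modCharHom cs p y = 0) : IsNilpotent y := by
  have := finite_index cs
  -- Ranks run from 0 to |B|, so |B| + 1 strict drops reach zero.
  have key : ∀ n ≤ Nat.card B + 1, y ^ n ∈ rankFiltration cs p (Nat.card B + 1 - n) := by
    intro n
    induction n with
    | zero =>
      intro _
      have h : {L : Set B | L.ncard < Nat.card B + 1} = Set.univ :=
        Set.eq_univ_of_forall fun L => Nat.lt_succ_of_le (Set.ncard_le_card L)
      rw [Nat.sub_zero, rankFiltration, h]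
      exact mem_span_xBar cs p _
    | succ n ih =>
      intro hn
      rw [pow_succ']
      refine mul_mem_rankFiltration cs p hy ?_
      rw [show Nat.card B + 1 - (n + 1) + 1 = Nat.card B + 1 - n by omega]
      exact ih (by omega)
  refine ⟨Nat.card B + 1, ?_⟩
  have h := key _ le_rfl
  have h0 : {L : Set B | L.ncard < 0} = ∅ :=
    Set.eq_empty_of_forall_notMem fun L => Nat.not_lt_zero _
  rwa [Nat.sub_self, rankFiltration, h0, Set.image_empty, Submodule.span_empty,
    Submodule.mem_bot] at h

theorem ker_modCharHom_le_jacobson :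
    RingHom.ker (modCharHom cs p) ≤ Ring.jacobson (ModularDescentAlgebra cs p) := by
  intro x hx
  rw [← Ideal.jacobson_bot, Ideal.mem_jacobson_iff]
  intro y
  have hn : IsNilpotent (y * x) := isNilpotent_of_modCharHom_eq_zero cs p (by
    rw [map_mul, RingHom.mem_ker.1 hx, mul_zero])
  obtain ⟨u, hu⟩ := hn.isUnit_add_one
  refine ⟨↑u⁻¹, ?_⟩
  rw [Ideal.mem_bot, mul_assoc, sub_eq_zero]
  have := u.inv_mul
  rw [hu, mul_add, mul_one] at this
  exact this

variable [Fact p.Prime]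

theorem jacobson_le_ker_modCharHom :
    Ring.jacobson (ModularDescentAlgebra cs p) ≤ RingHom.ker (modCharHom cs p) := by
  intro x hx
  rw [RingHom.mem_ker]
  ext w
  let f : ModularDescentAlgebra cs p →+* ZMod p :=
    (Pi.evalRingHom (fun _ : W => ZMod p) w).comp (modCharHom cs p).toRingHom
  have hf : Function.Surjective f := ZMod.ringHom_surjective f
  have : RingHomSurjective f := ⟨hf⟩
  have h := Ring.le_comap_jacobson f hx
  have : (⊥ : Ideal (ZMod p)).IsMaximal := Ideal.bot_isMaximal
  exact Ring.jacobson_le_of_isMaximal ⊥ h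

theorem jacobson_eq_ker :
    Ring.jacobson (ModularDescentAlgebra cs p) = RingHom.ker (modCharHom cs p) :=
  le_antisymm (jacobson_le_ker_modCharHom cs p) (ker_modCharHom_le_jacobson cs p)

/-- The index `[N_W(W_J) : W_J]`. -/
def normIndex (J : Set B) : ℕ :=
  (parabolic cs J).relIndex (Subgroup.normalizer (parabolic cs J : Set W))

/-- The generators of the radical. -/
def radicalGenerators : Set (ModularDescentAlgebra cs p) :=
  {y | ∃ J K : Set B, ConjSubsets cs J K ∧ y = xBar cs p J - xBar cs p K} ∪
    {y | ∃ J : Set B, p ∣ normIndex cs J ∧ y = xBar cs p J}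

theorem modCharHom_eq_zero_of_mem_span {y : ModularDescentAlgebra cs p}
    (hy : y ∈ Submodule.span (ZMod p) (radicalGenerators cs p)) : modCharHom cs p y = 0 := by
  induction hy using Submodule.span_induction with
  | mem y hy =>
    ext w
    rcases hy with ⟨J, K, h, rfl⟩ | ⟨J, h, rfl⟩
    · rw [map_sub, Pi.sub_apply, modCharHom_xBar, modCharHom_xBar,
        permChar_eq_of_conjSubsets cs h, sub_self, Pi.zero_apply]
    · rw [modCharHom_xBar, permChar, Int.cast_natCast, Pi.zero_apply, ZMod.natCast_eq_zero_iff]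
      exact h.trans (relIndex_normalizer_dvd_card_fixedBy _ w)
  | zero => simp
  | add u v _ _ hu hv => rw [map_add, hu, hv, add_zero]
  | smul a v _ hv => rw [map_smul, hv, smul_zero]

/-- Take K of maximal size in the support. At c_K any other J in the support contributes zero, since
otherwise it would be conjugate to K; this leaves h(K) times an index prime to p. -/
theorem eq_zero_of_sum_mem_ker [Fintype B] {h : Set B → ZMod p}
    (h0 : ∀ J, p ∣ normIndex cs J → h J = 0)
    (hr : ∀ J K, ConjSubsets cs J K → h J ≠ 0 → h K ≠ 0 → J = K)
    (hker : modCharHom cs p (∑ J : Set B, h J • xBar cs p J) = 0) (K : Set B) : h K = 0 := by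
  classical
  by_contra hK
  obtain ⟨K, hK, hmax⟩ := (Finset.univ.filter fun J => h J ≠ 0).exists_max_image Set.ncard
    ⟨K, by simpa using hK⟩
  simp only [Finset.mem_filter, Finset.mem_univ, true_and] at hK hmax
  have h1 := congrFun hker (coxeterElt cs K)
  rw [map_sum, Finset.sum_apply, Finset.sum_eq_single K] at h1
  · rw [map_smul, Pi.smul_apply, modCharHom_xBar, permChar_coxeterElt_self, smul_eq_mul,
      Pi.zero_apply, mul_eq_zero, Int.cast_natCast, ZMod.natCast_eq_zero_iff] at h1
    exact hK (h1.elim id (h0 K))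
  · intro J _ hJK
    rw [map_smul, Pi.smul_apply, modCharHom_xBar, smul_eq_mul]
    by_cases hJ : h J = 0
    · rw [hJ, zero_mul]
    have : permChar cs J (coxeterElt cs K) = 0 := by
      by_contra hne
      exact hJK (hr J K (conjSubsets_of_permChar_ne_zero cs (hmax J hJ) hne) hJ hK)
    rw [this, Int.cast_zero, mul_zero]
  · simp

theorem mem_span_of_modCharHom_eq_zero {y : ModularDescentAlgebra cs p}
    (hy : modCharHom cs p y = 0) : y ∈ Submodule.span (ZMod p) (radicalGenerators cs p) := by
  classical
  have := finite_index cs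
  have := Fintype.ofFinite B
  set U := Submodule.span (ZMod p) (radicalGenerators cs p)
  let s : Setoid (Set B) := ⟨ConjSubsets cs, conjSubsets_equivalence cs⟩
  let r : Set B → Set B := fun J => (Quotient.mk s J).out
  have hrJ : ∀ J, ConjSubsets cs J (r J) := fun J =>
    (conjSubsets_equivalence cs).symm (Quotient.mk_out (s := s) J)
  have hrr : ∀ J K, ConjSubsets cs J K → r J = r K := fun J K h => by
    have : Quotient.mk s J = Quotient.mk s K := Quotient.sound h
    simp only [r, this]
  have hy' := mem_span_xBar cs p y
  rw [Set.image_univ, Submodule.mem_span_range_iff_exists_fun] at hy'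
  obtain ⟨f, rfl⟩ := hy'
  -- Modulo the generators, coefficients can be gathered on class representatives, and those whose
  -- index is divisible by p discarded.
  let h : Set B → ZMod p := fun K => if p ∣ normIndex cs K then 0 else ∑ J with r J = K, f J
  have hsub : ∑ J, f J • xBar cs p J - ∑ K, h K • xBar cs p K ∈ U := by
    have e : ∑ J, f J • xBar cs p J - ∑ K, h K • xBar cs p K =
        ∑ J, f J • (xBar cs p J - xBar cs p (r J)) +
        ∑ K, ((∑ J with r J = K, f J) - h K) • xBar cs p K := by
      have : ∑ K, (∑ J with r J = K, f J) • xBar cs p K = ∑ J, f J • xBar cs p (r J) := by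
        refine (Finset.sum_congr rfl fun K _ => ?_).trans (Finset.sum_fiberwise Finset.univ r _)
        rw [Finset.sum_smul]
        refine Finset.sum_congr rfl fun J hJ => ?_
        rw [(Finset.mem_filter.1 hJ).2]
      simp only [sub_smul, smul_sub, Finset.sum_sub_distrib, this]
      abel
    rw [e]
    refine add_mem (sum_mem fun J _ => Submodule.smul_mem _ _ (Submodule.subset_span ?_))
      (sum_mem fun K _ => ?_)
    · exact Or.inl ⟨J, r J, hrJ J, rfl⟩
    · by_cases hK : p ∣ normIndex cs K
      · exact Submodule.smul_mem _ _ (Submodule.subset_span (Or.inr ⟨K, hK, rfl⟩))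
      · simp [h, hK]
  have hker := modCharHom_eq_zero_of_mem_span cs p hsub
  rw [map_sub, hy, zero_sub, neg_eq_zero] at hker
  have hzero := eq_zero_of_sum_mem_ker cs p (h := h) (fun J hJ => by simp [h, hJ]) ?_ hker
  · simpa [hzero] using hsub
  · have hfix : ∀ J, h J ≠ 0 → r J = J := by
      intro J hJ
      by_contra hne
      refine hJ ?_
      simp only [h]
      split_ifs
      · rfl
      · refine Finset.sum_eq_zero fun L hL => absurd ?_ hne
        have := (Finset.mem_filter.1 hL).2
        rw [← this]
        exact (hrr _ _ (hrJ L)).symm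
    intro J K hJK hJ hK
    rw [← hfix J hJ, ← hfix K hK, hrr J K hJK]

end Modular

end

end DescentAlgebra

open DescentAlgebra in
theorem theorem3p1 {B W : Type*} [Group W] [Finite W] {M : CoxeterMatrix B}
    (cs : CoxeterSystem M W) (p : ℕ) [Fact p.Prime] :
    -- `𝓩_W` is the `ℤ`-span of the elements `x_J`
    Subalgebra.toSubmodule (integralDescentRing cs)
        = Submodule.span ℤ (Set.range (xElt cs)) ∧
    -- the homomorphism `θ` with `θ(x_J) = χ_J`, and its reduction `φ` modulo `p`
    (∃ θ : integralDescentRing cs →ₐ[ℤ] (W → ℤ),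
      (∀ J : Set B, θ (xInt cs J) = permChar cs J) ∧
      ∃ φ : ModularDescentAlgebra cs p →ₐ[ZMod p] (W → ZMod p),
        (∀ (x : integralDescentRing cs) (w : W),
          φ (reduction cs p x) w = ((θ x w : ℤ) : ZMod p)) ∧
        Ring.jacobson (ModularDescentAlgebra cs p) = RingHom.ker φ) ∧
    (Ring.jacobson (ModularDescentAlgebra cs p)).restrictScalars (ZMod p)
      = Submodule.span (ZMod p)
          ({y | ∃ J K : Set B, ConjSubsets cs J K ∧ y = xBar cs p J - xBar cs p K} ∪
           {y | ∃ J : Set B,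
              p ∣ (parabolic cs J).relIndex (Subgroup.normalizer (parabolic cs J : Set W)) ∧
              y = xBar cs p J}) := by
  refine ⟨toSubmodule_integralDescentRing cs, ⟨charHom cs, charHom_xInt cs, modCharHom cs p,
    modCharHom_reduction cs p, jacobson_eq_ker cs p⟩, ?_⟩
  ext y
  rw [Submodule.restrictScalars_mem, jacobson_eq_ker, RingHom.mem_ker]
  exact ⟨mem_span_of_modCharHom_eq_zero cs p, modCharHom_eq_zero_of_mem_span cs p⟩
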